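/- Let $n\ge 1$ and let $A_n$ be the path graph $1-2-\cdots-n$. Let $P_{A_n}$ be the cone of positive definite real symmetric $n\times n$ matrices $y$ with $y_{ij}=0$ for $|i-j|>1$. Let $I_{A_n}$ be the space of symmetric $n\times n$ matrices $\eta$ of which only the coefficients $\eta_{ii}$ $(1\le i\le n)$ and $\eta_{i,i+1}=\eta_{i+1,i}$ $(1\le i\le n-1)$ are given, with the Lebesgue measure $d\eta=\prod_{i=1}^n d\eta_{ii}\prod_{i=1}^{n-1}d\eta_{i,i+1}$, and put $\operatorname{tr}(y\eta)=\sum_{|i-j|\le 1}y_{ij}\eta_{ij}$. Let $$Q_{A_n}=\{\eta\in I_{A_n}:\ \operatorname{tr}(y\eta)>0\ \text{ for all } y\in\overline{P_{A_n}}\setminus\{0\}\}$$ be the dual cone. Write $\{i:j\}=\{i,i+1,\dots,j\}$, write $|y_{J}|$ and $|\eta_J|$ for the determinant of the submatrix with rows and columns indexed by $J$, and for $\underline s=(s_1,\dots,s_n)\in\mathbb R^n$ put $s_0=s_{n+1}=0$. For $1\le M\le n$, $y\in P_{A_n}$ and $\eta\in Q_{A_n}$ define $$\Delta^{(M)}_{\underline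 s}(y)=\prod_{i=1}^{M-1}|y_{\{1:i\}}|^{s_i-s_{i+1}}\ |y|^{s_M}\prod_{i=M+1}^{n}|y_{\{i:n\}}|^{s_i-s_{i-1}},$$ $$\delta^{(M)}_{\underline s}(\eta)=\frac{\prod_{i=1}^{M-1}|\eta_{\{i:i+1\}}|^{s_i}\ \prod_{i=M+1}^{n}|\eta_{\{i-1:i\}}|^{s_i}}{\prod_{i=2}^{M-1}\eta_{ii}^{s_{i-1}}\cdot\eta_{MM}^{s_{M-1}-s_M+s_{M+1}}\cdot\prod_{i=M+1}^{n-1}\eta_{ii}^{s_{i+1}}},$$ and let $\varphi_{A_1}(\eta)=\eta^{-1}$ and, for $n\ge 2$, $\varphi_{A_n}(\eta)=\prod_{i=1}^{n-1}|\eta_{\{i:i+1\}}|^{-3/2}\prod_{i=2}^{n-1}\eta_{ii}$ (empty products are $1$). Theorem. For all $n\ge1$, all $1\le M\le n$, all $\underline s\in\mathbb R^n$ and all $y\in P_{A_n}$, the integral $\int_{Q_{A_n}}e^{-\operatorname{tr}(y\eta)}\,\delta^{(M)}_{\underline s}(\eta)\,\varphi_{A_n}(\eta)\,d\eta$ converges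 if and only if $s_i>\frac12$ for all $i\ne M$ and $s_M>0$. In this case $$\int_{Q_{A_n}}e^{-\operatorname{tr}(y\eta)}\,\delta^{(M)}_{\underline s}(\eta)\,\varphi_{A_n}(\eta)\,d\eta=\pi^{(n-1)/2}\Bigl\{\prod_{i\ne M}\Gamma\bigl(s_i-\tfrac12\bigr)\Bigr\}\,\Gamma(s_M)\,\Delta^{(M)}_{-\underline s}(y).$$ -/

import Mathlib

namespace AnGraph

open MeasureTheory

noncomputable section

/-- One-based reading of a vector: `at1 v i` is the `i`-th entry `v_i` for `1 ≤ i ≤ n`, and `0` for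
every other `i`; in particular `s_0 = s_{n+1} = 0`. -/
def at1 {n : ℕ} (v : Fin n → ℝ) (i : ℕ) : ℝ :=
  if h : 1 ≤ i ∧ i ≤ n then v ⟨i - 1, by omega⟩ else 0

/-- The space `Z` of real symmetric `n × n` matrices whose `(i, j)` entry vanishes whenever `i ≠ j`
and `i`, `j` are not adjacent in the path graph `1 - 2 - ⋯ - n`. -/
def Z (n : ℕ) : Set (Matrix (Fin n) (Fin n) ℝ) :=
  {y | y.IsSymm ∧ ∀ i j, i ≠ j → ¬ (SimpleGraph.pathGraph n).Adj i j → y i j = 0}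

/-- The cone of positive definite matrices in `Z`. -/
def P (n : ℕ) : Set (Matrix (Fin n) (Fin n) ℝ) :=
  {y | y ∈ Z n ∧ y.PosDef}

/-- The dual space of `Z`: symmetric matrices of which only the coefficients on the diagonal and on
the edges of the path graph are given. An element is the pair of the vector of the `η_{ii}`,
`1 ≤ i ≤ n`, and the vector of the `η_{i,i+1}`, `1 ≤ i ≤ n - 1`; the Lebesgue measure `volume` is
`∏_i dη_{ii} ∏_i dη_{i,i+1}`. -/
abbrev I (n : ℕ) : Type := (Fin n → ℝ) × (Fin (n - 1) → ℝ)

/-- The diagonal coefficient `η_{ii}` (one-based). -/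
def diagCoeff {n : ℕ} (η : I n) (i : ℕ) : ℝ := at1 η.1 i

/-- The coefficient `η_{i,i+1} = η_{i+1,i}` (one-based). -/
def edgeCoeff {n : ℕ} (η : I n) (i : ℕ) : ℝ := at1 η.2 i

/-- The symmetric matrix with the given coefficients of `η`; the coefficients that are not given are
filled with `0`. They do not contribute to the trace of the product with an element of `Z`. -/
def toMatrix {n : ℕ} (η : I n) : Matrix (Fin n) (Fin n) ℝ :=
  Matrix.of fun i j =>
    if i = j then diagCoeff η (i.val + 1)
    else if i.val + 1 = j.val then edgeCoeff η (i.val + 1)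
    else if j.val + 1 = i.val then edgeCoeff η (j.val + 1)
    else 0

/-- The pairing `tr (y η)`. -/
def pairing {n : ℕ} (y : Matrix (Fin n) (Fin n) ℝ) (η : I n) : ℝ :=
  (y * toMatrix η).trace

/-- The (open) dual cone of `P n`. -/
def Q (n : ℕ) : Set (I n) :=
  {η | ∀ y ∈ closure (P n) \ {0}, 0 < pairing y η}

/-- The determinant of the submatrix of `y` with rows and columns `i, i + 1, …, j` (one-based). -/
def blockDet {n : ℕ} (y : Matrix (Fin n) (Fin n) ℝ) (i j : ℕ) : ℝ :=
  (y.toSquareBlockProp fun v : Fin n => i ≤ v.val + 1 ∧ v.val + 1 ≤ j).det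

/-- The determinant of the submatrix of `η` with rows and columns `i, i + 1` (one-based). -/
def edgeDet {n : ℕ} (η : I n) (i : ℕ) : ℝ :=
  Matrix.det !![diagCoeff η i, edgeCoeff η i; edgeCoeff η i, diagCoeff η (i + 1)]

/-- The power function `Δ_s^{(M)}` on `P n` (`M` one-based). -/
def powP {n : ℕ} (M : ℕ) (s : Fin n → ℝ) (y : Matrix (Fin n) (Fin n) ℝ) : ℝ :=
  (∏ i ∈ Finset.Icc 1 (M - 1), blockDet y 1 i ^ (at1 s i - at1 s (i + 1)))
    * y.det ^ at1 s M
    * ∏ i ∈ Finset.Icc (M + 1) n, blockDet y i n ^ (at1 s i - at1 s (i - 1))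

/-- The power function `δ_s^{(M)}` on `Q n` (`M` one-based). -/
def powQ {n : ℕ} (M : ℕ) (s : Fin n → ℝ) (η : I n) : ℝ :=
  ((∏ i ∈ Finset.Icc 1 (M - 1), edgeDet η i ^ at1 s i)
      * ∏ i ∈ Finset.Icc (M + 1) n, edgeDet η (i - 1) ^ at1 s i)
    / ((∏ i ∈ Finset.Icc 2 (M - 1), diagCoeff η i ^ at1 s (i - 1))
      * diagCoeff η M ^ (at1 s (M - 1) - at1 s M + at1 s (M + 1))
      * ∏ i ∈ Finset.Icc (M + 1) (n - 1), diagCoeff η i ^ at1 s (i + 1))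

/-- The function `φ` on `Q n`. -/
def phi {n : ℕ} (η : I n) : ℝ :=
  if n = 1 then (diagCoeff η 1)⁻¹
  else (∏ i ∈ Finset.Icc 1 (n - 1), edgeDet η i ^ (-(3 / 2) : ℝ))
    * ∏ i ∈ Finset.Icc 2 (n - 1), diagCoeff η i

/-- The integrand `exp (-tr (y η)) δ_s^{(M)}(η) φ(η)` (`M` one-based). -/
def integrand {n : ℕ} (M : ℕ) (s : Fin n → ℝ) (y : Matrix (Fin n) (Fin n) ℝ) (η : I n) : ℝ :=
  Real.exp (-pairing y η) * powQ M s η * phi η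

end

end AnGraph

/-!
Root the path at the vertex `M` and call the neighbour of `i` on the side of `M` the parent `p(i)`.
On the cone the function `δ_s^{(M)} φ` is a product over the vertices: the root contributes
`η_{MM} ^ (s_M - 1)`, and every other vertex contributes
`(η_{ii} η_{p(i)p(i)} - η_{i,p(i)} ^ 2) ^ (s_i - 3/2) * η_{p(i)p(i)} ^ (1 - s_i)`
(`powQ_mul_phi_eq`, `weight_eq_ofReal`). A leaf can therefore be integrated out. Completing the
square turns the integral over its two coefficients into the product of an Euler integral and a
Gaussian integral, equal to `√π Γ(s_i - 1/2) y_{ii} ^ (-s_i)` times an exponential in `η_{p(i)p(i)}`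
(`lintegral_leaf`). This exponential has the effect of replacing `y` by the Schur complement of
`y_{ii}` (`pairing_snocI`), and `Δ_{-s}^{(M)}` satisfies the matching recursion
(`powP_eq_schurLast`). Induction on `n` removes the last vertex as long as it is not the root; if it
is, the path is reflected first (`laplace_eq`).

All integrals are taken in `[0, ∞]`, where the Euler integral equals `∞` if its parameter is not
positive. The same computation thus yields the value and the condition for convergence: the other
factors are positive and finite.

The dual cone is described by the positivity of its diagonal coefficients and edge determinants
(`Q_eq_edgeCone`). These conditions are necessary, as rank one matrices supported on an edge
show. They are sufficient, because the same Schur complements show that the pairing with `P` is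
nonnegative, and strictness follows since the conditions define an open set.
-/

namespace AnGraph

open MeasureTheory Set
open scoped ENNReal

noncomputable section

/-! ### Gamma integrals with values in `[0, ∞]` -/

/-- The value in `[0, ∞]` of Euler's integral `∫_0^∞ t ^ (r - 1) exp (-t) dt`: the number `Γ(r)` for
`0 < r`, and `∞` for `r ≤ 0`. -/
def gammaENN (r : ℝ) : ℝ≥0∞ := if 0 < r then ENNReal.ofReal (Real.Gamma r) else ⊤

lemma gammaENN_ne_zero (r : ℝ) : gammaENN r ≠ 0 := by
  unfold gammaENN
  split_ifs with h
  · simpa using Real.Gamma_pos_of_pos h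
  · simp

lemma gammaENN_lt_top_iff (r : ℝ) : gammaENN r < ⊤ ↔ 0 < r := by
  unfold gammaENN
  split_ifs with h <;> simp [h]

lemma integrableOn_rpow_mul_exp_neg_mul_iff {r a : ℝ} (ha : 0 < a) :
    IntegrableOn (fun t : ℝ => t ^ (r - 1) * Real.exp (-(a * t))) (Ioi 0) ↔ 0 < r := by
  constructor
  · intro h
    -- near `0` the exponential is bounded below, so `t ^ (r - 1)` would be integrable on `(0, 1)`
    have h1 : IntegrableOn (fun t : ℝ => t ^ (r - 1) * Real.exp (-(a * t))) (Ioo 0 1) :=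
      h.mono_set Ioo_subset_Ioi_self
    have h2 : IntegrableOn (fun t : ℝ => t ^ (r - 1)) (Ioo 0 1) := by
      refine Integrable.mono' (h1.const_mul (Real.exp a))
        ((Measurable.pow_const measurable_id _).aestronglyMeasurable) ?_
      refine (ae_restrict_iff' measurableSet_Ioo).2 (ae_of_all _ fun t ht => ?_)
      have h0 : 0 ≤ t ^ (r - 1) := Real.rpow_nonneg ht.1.le _
      rw [Real.norm_of_nonneg h0, mul_left_comm, ← Real.exp_add]
      exact le_mul_of_one_le_right h0 (Real.one_le_exp (by nlinarith [ht.2]))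
    rw [intervalIntegral.integrableOn_Ioo_rpow_iff one_pos] at h2
    linarith
  · intro hr
    by_contra hcon
    have h1 := Real.integral_rpow_mul_exp_neg_mul_Ioi hr ha
    rw [integral_undef hcon] at h1
    have := mul_pos (Real.rpow_pos_of_pos (one_div_pos.2 ha) r) (Real.Gamma_pos_of_pos hr)
    linarith

lemma lintegral_rpow_mul_exp_neg_mul {a : ℝ} (ha : 0 < a) (r : ℝ) :
    ∫⁻ t in Ioi (0 : ℝ), ENNReal.ofReal (t ^ (r - 1) * Real.exp (-(a * t)))
      = gammaENN r * ENNReal.ofReal (a ^ (-r)) := by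
  have hpos : 0 ≤ᵐ[volume.restrict (Ioi (0 : ℝ))]
      fun t : ℝ => t ^ (r - 1) * Real.exp (-(a * t)) :=
    (ae_restrict_iff' measurableSet_Ioi).2 (ae_of_all _ fun t ht =>
      mul_nonneg (Real.rpow_nonneg (le_of_lt ht) _) (Real.exp_pos _).le)
  have hmeas : Measurable fun t : ℝ => t ^ (r - 1) * Real.exp (-(a * t)) := by fun_prop
  unfold gammaENN
  split_ifs with hr
  · rw [← ofReal_integral_eq_lintegral_ofReal
      ((integrableOn_rpow_mul_exp_neg_mul_iff ha).2 hr) hpos,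
      Real.integral_rpow_mul_exp_neg_mul_Ioi hr ha,
      ← ENNReal.ofReal_mul (Real.Gamma_pos_of_pos hr).le, mul_comm, one_div,
      Real.inv_rpow ha.le, Real.rpow_neg ha.le]
  · rw [ENNReal.top_mul (by simpa using Real.rpow_pos_of_pos ha _)]
    by_contra hcon
    refine hr ((integrableOn_rpow_mul_exp_neg_mul_iff ha).1
      ⟨hmeas.aestronglyMeasurable, ?_⟩)
    rw [hasFiniteIntegral_iff_ofReal hpos]
    exact lt_top_iff_ne_top.2 hcon

/-! ### The weight of one edge -/

/-- The factor that a vertex with coefficient `x` contributes to the integrand, when its neighbour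
towards the root has coefficient `p` and the edge between them has coefficient `c`. It is supported
on `0 < p`, `0 < x p - c ^ 2`. -/
def edgeWeight (σ x p c : ℝ) : ℝ≥0∞ :=
  if 0 < p ∧ 0 < x * p - c ^ 2 then
    ENNReal.ofReal ((x * p - c ^ 2) ^ (σ - 3 / 2) * p ^ (1 - σ)) else 0

@[fun_prop]
lemma measurable_edgeWeight (σ : ℝ) {α : Type*} [MeasurableSpace α] {x p c : α → ℝ}
    (hx : Measurable x) (hp : Measurable p) (hc : Measurable c) :
    Measurable fun t => edgeWeight σ (x t) (p t) (c t) := by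
  unfold edgeWeight
  have hd : Measurable fun t => x t * p t - c t ^ 2 := by fun_prop
  exact Measurable.ite ((measurableSet_lt measurable_const hp).inter
    (measurableSet_lt measurable_const hd)) (by fun_prop) measurable_const

lemma lintegral_exp_neg_mul_sq {k : ℝ} (hk : 0 < k) (d : ℝ) :
    ∫⁻ c : ℝ, ENNReal.ofReal (Real.exp (-(k * (c + d) ^ 2)))
      = ENNReal.ofReal √(Real.pi / k) := by
  rw [lintegral_add_right_eq_self (fun c : ℝ => ENNReal.ofReal (Real.exp (-(k * c ^ 2)))) d]
  simp only [← neg_mul]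
  rw [← ofReal_integral_eq_lintegral_ofReal (integrable_exp_neg_mul_sq hk)
    (ae_of_all _ fun c => (Real.exp_pos _).le), integral_gaussian]

/-- The integral over a leaf and its edge. Completing the square, `x = t + c ^ 2 / p`, makes it the
product of an Euler integral in `t` and a Gaussian integral in `c`; the value does not depend on
`p`. -/
lemma lintegral_leaf {a p : ℝ} (ha : 0 < a) (hp : 0 < p) (σ b : ℝ) :
    ∫⁻ c : ℝ, ∫⁻ x : ℝ, edgeWeight σ x p c
        * ENNReal.ofReal (Real.exp (-(a * x + 2 * b * c + b ^ 2 / a * p)))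
      = ENNReal.ofReal √Real.pi * gammaENN (σ - 1 / 2) * ENNReal.ofReal (a ^ (-σ)) := by
  have hinner : ∀ c : ℝ, ∫⁻ x : ℝ, edgeWeight σ x p c
        * ENNReal.ofReal (Real.exp (-(a * x + 2 * b * c + b ^ 2 / a * p)))
      = gammaENN (σ - 1 / 2) * ENNReal.ofReal (a ^ (-(σ - 1 / 2)))
        * (ENNReal.ofReal (p ^ (-(1 / 2) : ℝ))
          * ENNReal.ofReal (Real.exp (-(a / p * (c + b * p / a) ^ 2)))) := by
    intro c
    rw [← lintegral_add_right_eq_self _ (c ^ 2 / p), ← lintegral_rpow_mul_exp_neg_mul ha,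
      ← ENNReal.ofReal_mul (Real.rpow_nonneg hp.le _), ← lintegral_mul_const' _ _ (by simp),
      ← lintegral_indicator measurableSet_Ioi]
    refine lintegral_congr fun t => ?_
    have hdet : (t + c ^ 2 / p) * p - c ^ 2 = t * p := by field_simp; ring
    simp only [edgeWeight, hdet, indicator, mem_Ioi, hp, true_and, mul_pos_iff_of_pos_right]
    split_ifs with ht
    · rw [← ENNReal.ofReal_mul (by positivity), ← ENNReal.ofReal_mul (by positivity)]
      congr 1
      have e1 : (t * p) ^ (σ - 3 / 2) * p ^ (1 - σ)
          = t ^ (σ - 1 / 2 - 1) * p ^ (-(1 / 2) : ℝ) := by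
        rw [Real.mul_rpow ht.le hp.le, mul_assoc, ← Real.rpow_add hp]
        congr 2 <;> ring
      have e2 : Real.exp (-(a * (t + c ^ 2 / p) + 2 * b * c + b ^ 2 / a * p))
          = Real.exp (-(a * t)) * Real.exp (-(a / p * (c + b * p / a) ^ 2)) := by
        rw [← Real.exp_add]
        congr 1
        field_simp
        ring
      rw [e1, e2]
      ring
    · simp
  simp only [hinner]
  rw [lintegral_const_mul _ (by fun_prop), lintegral_const_mul _ (by fun_prop),
    lintegral_exp_neg_mul_sq (div_pos ha hp), mul_assoc, mul_comm (ENNReal.ofReal √Real.pi),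
    mul_assoc]
  congr 1
  rw [← ENNReal.ofReal_mul (by positivity), ← ENNReal.ofReal_mul (by positivity),
    ← ENNReal.ofReal_mul (by positivity)]
  congr 1
  have e3 : √(Real.pi / (a / p)) = √Real.pi * a ^ (-(1 / 2) : ℝ) * p ^ (1 / 2 : ℝ) := by
    rw [show Real.pi / (a / p) = Real.pi * a⁻¹ * p by field_simp, Real.sqrt_mul (by positivity),
      Real.sqrt_mul (by positivity), Real.sqrt_inv, Real.sqrt_eq_rpow a, Real.sqrt_eq_rpow p,
      Real.rpow_neg ha.le]
  have e4 : a ^ (-σ) = a ^ (-(σ - 1 / 2)) * a ^ (-(1 / 2) : ℝ) := by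
    rw [← Real.rpow_add ha]
    congr 1
    ring
  have e5 : p ^ (-(1 / 2) : ℝ) * p ^ (1 / 2 : ℝ) = 1 := by
    rw [← Real.rpow_add hp]
    norm_num
  rw [e3, e4]
  linear_combination (a ^ (-(σ - 1 / 2)) * √Real.pi * a ^ (-(1 / 2) : ℝ)) * e5

/-! ### Appending and removing the last vertex -/

lemma at1_snoc_of_le {n : ℕ} (v : Fin n → ℝ) (x : ℝ) {i : ℕ} (hi : i ≤ n) :
    at1 (Fin.snoc v x : Fin (n + 1) → ℝ) i = at1 v i := by
  unfold at1
  by_cases h : 1 ≤ i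
  · rw [dif_pos ⟨h, by omega⟩, dif_pos ⟨h, hi⟩]
    exact Fin.snoc_castSucc (α := fun _ => ℝ) x v ⟨i - 1, by omega⟩
  · rw [dif_neg (by omega), dif_neg (by omega)]

lemma at1_snoc_last {n : ℕ} (v : Fin n → ℝ) (x : ℝ) :
    at1 (Fin.snoc v x : Fin (n + 1) → ℝ) (n + 1) = x := by
  unfold at1
  rw [dif_pos ⟨by omega, le_rfl⟩]
  exact Fin.snoc_last (α := fun _ => ℝ) x v

lemma at1_init {n : ℕ} (s : Fin (n + 1) → ℝ) {i : ℕ} (hi : i ≤ n) :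
    at1 (Fin.init s : Fin n → ℝ) i = at1 s i := by
  rw [← at1_snoc_of_le (Fin.init s : Fin n → ℝ) (s (Fin.last n)) hi]
  congr 1
  exact Fin.snoc_init_self s

lemma at1_fin {n : ℕ} (v : Fin n → ℝ) (i : Fin n) : at1 v (i.val + 1) = v i := by
  unfold at1
  rw [dif_pos ⟨by omega, by omega⟩]
  rfl

@[fun_prop]
lemma measurable_at1 {n : ℕ} (i : ℕ) : Measurable fun v : Fin n → ℝ => at1 v i := by
  unfold at1
  split_ifs
  · fun_prop
  · exact measurable_const

/-- The incomplete matrix `η`, extended by a new last vertex with diagonal coefficient `x` and edge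
coefficient `c`. -/
def snocI {k : ℕ} (η : I (k + 1)) (x c : ℝ) : I (k + 2) :=
  ((Fin.snoc η.1 x : Fin (k + 2) → ℝ), (Fin.snoc (n := k) η.2 c : Fin (k + 1) → ℝ))

lemma diagCoeff_snocI_of_le {k : ℕ} (η : I (k + 1)) (x c : ℝ) {i : ℕ} (hi : i ≤ k + 1) :
    diagCoeff (snocI η x c) i = diagCoeff η i :=
  at1_snoc_of_le η.1 x hi

lemma diagCoeff_snocI_last {k : ℕ} (η : I (k + 1)) (x c : ℝ) :
    diagCoeff (snocI η x c) (k + 2) = x :=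
  at1_snoc_last η.1 x

lemma edgeCoeff_snocI_of_le {k : ℕ} (η : I (k + 1)) (x c : ℝ) {i : ℕ} (hi : i ≤ k) :
    edgeCoeff (snocI η x c) i = edgeCoeff η i :=
  at1_snoc_of_le (n := k) η.2 c hi

lemma edgeCoeff_snocI_last {k : ℕ} (η : I (k + 1)) (x c : ℝ) :
    edgeCoeff (snocI η x c) (k + 1) = c :=
  at1_snoc_last (n := k) η.2 c

@[fun_prop]
lemma measurable_diagCoeff {n : ℕ} (i : ℕ) : Measurable fun η : I n => diagCoeff η i := by
  unfold diagCoeff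
  fun_prop

@[fun_prop]
lemma measurable_edgeCoeff {n : ℕ} (i : ℕ) : Measurable fun η : I n => edgeCoeff η i := by
  unfold edgeCoeff
  fun_prop

lemma measurable_snoc (n : ℕ) :
    Measurable fun z : (Fin n → ℝ) × ℝ => (Fin.snoc z.1 z.2 : Fin (n + 1) → ℝ) := by
  refine measurable_pi_lambda _ fun i => ?_
  refine Fin.lastCases ?_ (fun j => ?_) i
  · simpa using measurable_snd
  · simp only [Fin.snoc_castSucc]
    fun_prop

lemma lintegral_snoc {n : ℕ} {f : (Fin (n + 1) → ℝ) → ℝ≥0∞} (hf : Measurable f) :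
    ∫⁻ v, f v = ∫⁻ v : Fin n → ℝ, ∫⁻ x : ℝ, f (Fin.snoc v x) := by
  have hmp := (volume_preserving_piFinSuccAbove (fun _ : Fin (n + 1) => ℝ) (Fin.last n)).symm
  rw [← hmp.lintegral_comp hf, Measure.volume_eq_prod,
    lintegral_prod_symm' (fun z => f ((MeasurableEquiv.piFinSuccAbove
      (fun _ : Fin (n + 1) => ℝ) (Fin.last n)).symm z)) (hf.comp (MeasurableEquiv.measurable _))]
  refine lintegral_congr fun v => lintegral_congr fun x => ?_
  congr 1
  exact Fin.insertNth_last' x v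

lemma lintegral_snocI {k : ℕ} {f : I (k + 2) → ℝ≥0∞} (hf : Measurable f) :
    ∫⁻ η, f η = ∫⁻ η : I (k + 1), ∫⁻ c : ℝ, ∫⁻ x : ℝ, f (snocI η x c) := by
  have hm : Measurable fun z : ((Fin (k + 1) → ℝ) × (Fin k → ℝ)) × (ℝ × ℝ) =>
      f (snocI (k := k) z.1 z.2.1 z.2.2) := by
    refine hf.comp (Measurable.prodMk ?_ ?_)
    · exact (measurable_snoc (k + 1)).comp
        (f := fun z : ((Fin (k + 1) → ℝ) × (Fin k → ℝ)) × (ℝ × ℝ) => (z.1.1, z.2.1)) (by fun_prop)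
    · exact (measurable_snoc k).comp
        (f := fun z : ((Fin (k + 1) → ℝ) × (Fin k → ℝ)) × (ℝ × ℝ) => (z.1.2, z.2.2)) (by fun_prop)
  have hm' : Measurable fun z : (((Fin (k + 1) → ℝ) × (Fin k → ℝ)) × ℝ) × ℝ =>
      f (snocI (k := k) z.1.1 z.2 z.1.2) :=
    hm.comp (f := fun z : (((Fin (k + 1) → ℝ) × (Fin k → ℝ)) × ℝ) × ℝ => (z.1.1, (z.2, z.1.2)))
      (by fun_prop)
  have hm'' : Measurable fun z : (((Fin (k + 1) → ℝ) × (Fin k → ℝ)) × ℝ) × ℝ =>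
      f (snocI (k := k) z.1.1 z.1.2 z.2) :=
    hm.comp (f := fun z : (((Fin (k + 1) → ℝ) × (Fin k → ℝ)) × ℝ) × ℝ => (z.1.1, (z.1.2, z.2)))
      (by fun_prop)
  calc ∫⁻ η, f η
      = ∫⁻ v : Fin (k + 2) → ℝ, ∫⁻ w : Fin (k + 1) → ℝ, f (v, w) := by
        rw [Measure.volume_eq_prod, lintegral_prod _ hf.aemeasurable]
        rfl
    _ = ∫⁻ v : Fin (k + 1) → ℝ, ∫⁻ x : ℝ, ∫⁻ w : Fin (k + 1) → ℝ,
          f ((Fin.snoc v x : Fin (k + 2) → ℝ), w) :=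
        lintegral_snoc (f := fun v => ∫⁻ w : Fin (k + 1) → ℝ, f (v, w))
          hf.lintegral_prod_right'
    _ = ∫⁻ v : Fin (k + 1) → ℝ, ∫⁻ x : ℝ, ∫⁻ w : Fin k → ℝ, ∫⁻ c : ℝ,
          f (snocI (k := k) (v, w) x c) := by
        refine lintegral_congr fun v => lintegral_congr fun x => ?_
        exact lintegral_snoc (f := fun w => f ((Fin.snoc v x : Fin (k + 2) → ℝ), w))
          (hf.comp measurable_prodMk_left)
    _ = ∫⁻ v : Fin (k + 1) → ℝ, ∫⁻ w : Fin k → ℝ, ∫⁻ c : ℝ, ∫⁻ x : ℝ,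
          f (snocI (k := k) (v, w) x c) := by
        refine lintegral_congr fun v => ?_
        rw [lintegral_lintegral_swap]
        · refine lintegral_congr fun w => ?_
          rw [lintegral_lintegral_swap]
          exact (hm.comp (f := fun z : ℝ × ℝ => ((v, w), z)) (by fun_prop)).aemeasurable
        · exact (hm''.lintegral_prod_right'.comp
            (f := fun z : ℝ × (Fin k → ℝ) => ((v, z.2), z.1)) (by fun_prop)).aemeasurable
    _ = _ := by
        rw [Measure.volume_eq_prod, lintegral_prod]
        · rfl
        · exact (hm'.lintegral_prod_right'.lintegral_prod_right').aemeasurable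

/-! ### The weight of the rooted path -/

/-- The factor that the root contributes to the integrand. -/
def rootWeight (σ x : ℝ) : ℝ≥0∞ := if 0 < x then ENNReal.ofReal (x ^ (σ - 1)) else 0

@[fun_prop]
lemma measurable_rootWeight (σ : ℝ) : Measurable (rootWeight σ) := by
  unfold rootWeight
  refine Measurable.ite (measurableSet_lt measurable_const measurable_id) ?_ measurable_const
  fun_prop

/-- The function `δ_s^{(M)} φ` on the cone, extended by `0`, as a product over the vertices of the
path rooted at `M`: every vertex other than the root contributes an `edgeWeight` that involves its
neighbour on the side of the root. -/
def weight {n : ℕ} (M : ℕ) (s : Fin n → ℝ) (η : I n) : ℝ≥0∞ :=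
  rootWeight (at1 s M) (diagCoeff η M)
    * ((∏ i ∈ Finset.Icc 1 (M - 1),
          edgeWeight (at1 s i) (diagCoeff η i) (diagCoeff η (i + 1)) (edgeCoeff η i))
      * ∏ i ∈ Finset.Icc (M + 1) n,
          edgeWeight (at1 s i) (diagCoeff η i) (diagCoeff η (i - 1)) (edgeCoeff η (i - 1)))

@[fun_prop]
lemma measurable_weight {n : ℕ} (M : ℕ) (s : Fin n → ℝ) : Measurable (weight M s) := by
  unfold weight
  fun_prop

lemma weight_snocI {k M : ℕ} (hMk : M ≤ k + 1) (s : Fin (k + 2) → ℝ) (η : I (k + 1)) (x c : ℝ) :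
    weight M s (snocI η x c)
      = weight M (Fin.init s : Fin (k + 1) → ℝ) η
        * edgeWeight (at1 s (k + 2)) x (diagCoeff η (k + 1)) c := by
  unfold weight
  rw [Finset.prod_Icc_succ_top (by omega : M + 1 ≤ k + 1 + 1), at1_init s hMk,
    diagCoeff_snocI_of_le η x c hMk, mul_assoc, mul_assoc]
  congr 2
  · refine Finset.prod_congr rfl fun i hi => ?_
    rw [Finset.mem_Icc] at hi
    rw [at1_init s (by omega), diagCoeff_snocI_of_le η x c (by omega),
      diagCoeff_snocI_of_le η x c (by omega), edgeCoeff_snocI_of_le η x c (by omega)]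
  · congr 1
    · refine Finset.prod_congr rfl fun i hi => ?_
      rw [Finset.mem_Icc] at hi
      rw [at1_init s (by omega), diagCoeff_snocI_of_le η x c (by omega),
        diagCoeff_snocI_of_le η x c (by omega), edgeCoeff_snocI_of_le η x c (by omega)]
    · rw [diagCoeff_snocI_last, Nat.add_sub_cancel, diagCoeff_snocI_of_le η x c le_rfl,
        edgeCoeff_snocI_last]

/-! ### The cone described by its edge determinants -/

/-- The incomplete matrices all of whose diagonal coefficients and edge determinants are
positive. -/
def edgeCone (n : ℕ) : Set (I n) :=
  {η | (∀ i, 1 ≤ i → i ≤ n → 0 < diagCoeff η i) ∧ ∀ i, 1 ≤ i → i < n → 0 < edgeDet η i}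

lemma edgeDet_eq {n : ℕ} (η : I n) (i : ℕ) :
    edgeDet η i = diagCoeff η i * diagCoeff η (i + 1) - edgeCoeff η i ^ 2 := by
  rw [edgeDet, Matrix.det_fin_two_of, sq]

lemma edgeWeight_ne_zero {σ x p c : ℝ} (h : edgeWeight σ x p c ≠ 0) :
    0 < x ∧ 0 < p ∧ 0 < x * p - c ^ 2 := by
  unfold edgeWeight at h
  split_ifs at h with h1
  · exact ⟨pos_of_mul_pos_left (by nlinarith [h1.2, sq_nonneg c]) h1.1.le, h1⟩
  · exact absurd rfl h

lemma mem_edgeCone_of_weight_ne_zero {n M : ℕ} {s : Fin n → ℝ}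
    {η : I n} (h : weight M s η ≠ 0) : η ∈ edgeCone n := by
  unfold weight at h
  rw [mul_ne_zero_iff, mul_ne_zero_iff, Finset.prod_ne_zero_iff, Finset.prod_ne_zero_iff] at h
  obtain ⟨h0, h1, h2⟩ := h
  have h0' : 0 < diagCoeff η M := by
    by_contra hc
    exact h0 (if_neg hc)
  constructor
  · intro i hi hin
    rcases lt_trichotomy i M with hlt | rfl | hgt
    · exact (edgeWeight_ne_zero (h1 i (by rw [Finset.mem_Icc]; omega))).1
    · exact h0'
    · exact (edgeWeight_ne_zero (h2 i (by rw [Finset.mem_Icc]; omega))).1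
  · intro i hi hin
    rw [edgeDet_eq]
    rcases lt_or_ge i M with hlt | hge
    · exact (edgeWeight_ne_zero (h1 i (by rw [Finset.mem_Icc]; omega))).2.2
    · have := (edgeWeight_ne_zero (h2 (i + 1) (by rw [Finset.mem_Icc]; omega))).2.2
      rwa [Nat.add_sub_cancel, mul_comm] at this

/-! ### The integrand as a product over the rooted path -/

lemma mul_prod_Icc_eq {n M : ℕ} (hn : 2 ≤ n) (hM1 : 1 ≤ M) (hMn : M ≤ n) (X : ℕ → ℝ) :
    X M * ∏ i ∈ Finset.Icc 2 (n - 1), X i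
      = (∏ i ∈ Finset.Icc 2 M, X i) * ∏ i ∈ Finset.Icc M (n - 1), X i := by
  rcases Nat.lt_or_ge M 2 with h | h
  · obtain rfl : M = 1 := by omega
    rw [← Finset.mul_prod_Ioc_eq_prod_Icc (by omega : 1 ≤ n - 1),
      ← Finset.Icc_add_one_left_eq_Ioc]
    simp
  · obtain ⟨m, rfl⟩ : ∃ m, M = m + 1 := ⟨M - 1, by omega⟩
    rw [Finset.prod_Icc_succ_top h, mul_comm (∏ i ∈ Finset.Icc 2 m, X i), mul_assoc]
    congr 1
    rw [← Finset.prod_union]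
    · congr 1
      ext i
      simp only [Finset.mem_union, Finset.mem_Icc]
      omega
    · rw [Finset.disjoint_left]
      intro i
      simp only [Finset.mem_Icc]
      omega

lemma prod_Icc_shift_left (M : ℕ) (hM : 1 ≤ M) (g : ℕ → ℝ) :
    ∏ i ∈ Finset.Icc 1 (M - 1), g (i + 1) = ∏ i ∈ Finset.Icc 2 M, g i := by
  refine Finset.prod_nbij' (· + 1) (· - 1) ?_ ?_ ?_ ?_ (fun _ _ => rfl) <;>
  · intro i hi
    simp only [Finset.mem_Icc] at *
    omega

lemma prod_Icc_shift_right (M n : ℕ) (hM : 1 ≤ M) (g : ℕ → ℝ) :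
    ∏ i ∈ Finset.Icc (M + 1) n, g (i - 1) = ∏ i ∈ Finset.Icc M (n - 1), g i := by
  refine Finset.prod_nbij' (· - 1) (· + 1) ?_ ?_ ?_ ?_ (fun _ _ => rfl) <;>
  · intro i hi
    simp only [Finset.mem_Icc] at *
    omega

lemma phi_mul_diagCoeff {n M : ℕ} (hM1 : 1 ≤ M) (hMn : M ≤ n) {η : I n} (hη : η ∈ edgeCone n) :
    phi η * diagCoeff η M
      = ((∏ i ∈ Finset.Icc 1 (M - 1), edgeDet η i ^ (-(3 / 2) : ℝ))
          * ∏ i ∈ Finset.Icc M (n - 1), edgeDet η i ^ (-(3 / 2) : ℝ))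
        * ((∏ i ∈ Finset.Icc 2 M, diagCoeff η i)
          * ∏ i ∈ Finset.Icc M (n - 1), diagCoeff η i) := by
  unfold phi
  split_ifs with h
  · subst h
    obtain rfl : M = 1 := by omega
    simp [(hη.1 1 le_rfl le_rfl).ne']
  · rw [← mul_prod_Icc_eq (by omega) hM1 hMn, mul_comm (diagCoeff η M), ← mul_assoc]
    congr 2
    rw [← Finset.prod_union]
    · congr 1
      ext i
      simp only [Finset.mem_union, Finset.mem_Icc]
      omega
    · rw [Finset.disjoint_left]
      intro i
      simp only [Finset.mem_Icc]
      omega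

lemma powQ_eq {n M : ℕ} (hM1 : 1 ≤ M) (hMn : M ≤ n) (s : Fin n → ℝ) {η : I n}
    (hη : η ∈ edgeCone n) :
    powQ M s η
      = ((∏ i ∈ Finset.Icc 1 (M - 1), edgeDet η i ^ at1 s i)
          * ∏ i ∈ Finset.Icc M (n - 1), edgeDet η i ^ at1 s (i + 1))
        * diagCoeff η M ^ at1 s M
        / ((∏ i ∈ Finset.Icc 2 M, diagCoeff η i ^ at1 s (i - 1))
          * ∏ i ∈ Finset.Icc M (n - 1), diagCoeff η i ^ at1 s (i + 1)) := by
  have hx : 0 < diagCoeff η M := hη.1 M hM1 hMn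
  -- the conventions `s_0 = 0` and `s_{n+1} = 0` make the factor of the root uniform in `M`
  have hL : ∏ i ∈ Finset.Icc 2 M, diagCoeff η i ^ at1 s (i - 1)
      = (∏ i ∈ Finset.Icc 2 (M - 1), diagCoeff η i ^ at1 s (i - 1))
        * diagCoeff η M ^ at1 s (M - 1) := by
    rcases Nat.lt_or_ge M 2 with h | h
    · obtain rfl : M = 1 := by omega
      simp [at1]
    · obtain ⟨m, rfl⟩ : ∃ m, M = m + 1 := ⟨M - 1, by omega⟩
      rw [Finset.prod_Icc_succ_top h, Nat.add_sub_cancel]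
  have hR : ∏ i ∈ Finset.Icc M (n - 1), diagCoeff η i ^ at1 s (i + 1)
      = diagCoeff η M ^ at1 s (M + 1)
        * ∏ i ∈ Finset.Icc (M + 1) (n - 1), diagCoeff η i ^ at1 s (i + 1) := by
    rcases Nat.lt_or_ge M n with h | h
    · rw [← Finset.mul_prod_Ioc_eq_prod_Icc (by omega), ← Finset.Icc_add_one_left_eq_Ioc]
    · obtain rfl : M = n := by omega
      rw [Finset.Icc_eq_empty (by omega), Finset.Icc_eq_empty (by omega)]
      simp [at1]
  have hS : ∏ i ∈ Finset.Icc (M + 1) n, edgeDet η (i - 1) ^ at1 s i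
      = ∏ i ∈ Finset.Icc M (n - 1), edgeDet η i ^ at1 s (i + 1) := by
    rw [← prod_Icc_shift_right M n hM1 (fun i => edgeDet η i ^ at1 s (i + 1))]
    refine Finset.prod_congr rfl fun i hi => ?_
    rw [Finset.mem_Icc] at hi
    rw [Nat.sub_add_cancel (by omega)]
  unfold powQ
  rw [hL, hR, hS, Real.rpow_add hx, Real.rpow_sub hx]
  have h1 := (Real.rpow_pos_of_pos hx (at1 s (M - 1))).ne'
  have h2 := (Real.rpow_pos_of_pos hx (at1 s (M + 1))).ne'
  have h3 := (Real.rpow_pos_of_pos hx (at1 s M)).ne'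
  generalize (∏ i ∈ Finset.Icc 2 (M - 1), diagCoeff η i ^ at1 s (i - 1)) = A
  generalize (∏ i ∈ Finset.Icc (M + 1) (n - 1), diagCoeff η i ^ at1 s (i + 1)) = B
  rw [show A * (diagCoeff η M ^ at1 s (M - 1) / diagCoeff η M ^ at1 s M
      * diagCoeff η M ^ at1 s (M + 1)) * B
    = (A * diagCoeff η M ^ at1 s (M - 1) * (diagCoeff η M ^ at1 s (M + 1) * B))
      / diagCoeff η M ^ at1 s M by field_simp, div_div_eq_mul_div]

lemma powQ_mul_phi_eq {n M : ℕ} (hM1 : 1 ≤ M) (hMn : M ≤ n) (s : Fin n → ℝ) {η : I n}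
    (hη : η ∈ edgeCone n) :
    powQ M s η * phi η
      = diagCoeff η M ^ (at1 s M - 1)
        * ((∏ i ∈ Finset.Icc 1 (M - 1),
              edgeDet η i ^ (at1 s i - 3 / 2) * diagCoeff η (i + 1) ^ (1 - at1 s i))
          * ∏ i ∈ Finset.Icc (M + 1) n,
              edgeDet η (i - 1) ^ (at1 s i - 3 / 2) * diagCoeff η (i - 1) ^ (1 - at1 s i)) := by
  have hx : 0 < diagCoeff η M := hη.1 M hM1 hMn
  have hL : ∏ i ∈ Finset.Icc 1 (M - 1),
        edgeDet η i ^ (at1 s i - 3 / 2) * diagCoeff η (i + 1) ^ (1 - at1 s i)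
      = (∏ i ∈ Finset.Icc 1 (M - 1), edgeDet η i ^ at1 s i)
        * (∏ i ∈ Finset.Icc 1 (M - 1), edgeDet η i ^ (-(3 / 2) : ℝ))
        * ((∏ i ∈ Finset.Icc 2 M, diagCoeff η i)
          / ∏ i ∈ Finset.Icc 2 M, diagCoeff η i ^ at1 s (i - 1)) := by
    rw [← Finset.prod_div_distrib, ← prod_Icc_shift_left M hM1
      (fun i => diagCoeff η i / diagCoeff η i ^ at1 s (i - 1)), ← Finset.prod_mul_distrib,
      ← Finset.prod_mul_distrib]
    refine Finset.prod_congr rfl fun i hi => ?_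
    rw [Finset.mem_Icc] at hi
    rw [sub_eq_add_neg, Real.rpow_add (hη.2 i (by omega) (by omega)),
      Real.rpow_sub (hη.1 (i + 1) (by omega) (by omega)), Real.rpow_one, Nat.add_sub_cancel]
  have hR : ∏ i ∈ Finset.Icc (M + 1) n,
        edgeDet η (i - 1) ^ (at1 s i - 3 / 2) * diagCoeff η (i - 1) ^ (1 - at1 s i)
      = (∏ i ∈ Finset.Icc M (n - 1), edgeDet η i ^ at1 s (i + 1))
        * (∏ i ∈ Finset.Icc M (n - 1), edgeDet η i ^ (-(3 / 2) : ℝ))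
        * ((∏ i ∈ Finset.Icc M (n - 1), diagCoeff η i)
          / ∏ i ∈ Finset.Icc M (n - 1), diagCoeff η i ^ at1 s (i + 1)) := by
    rw [← Finset.prod_div_distrib, ← Finset.prod_mul_distrib, ← Finset.prod_mul_distrib,
      ← prod_Icc_shift_right M n hM1]
    refine Finset.prod_congr rfl fun i hi => ?_
    rw [Finset.mem_Icc] at hi
    rw [sub_eq_add_neg, Real.rpow_add (hη.2 (i - 1) (by omega) (by omega)),
      Real.rpow_sub (hη.1 (i - 1) (by omega) (by omega)), Real.rpow_one,
      Nat.sub_add_cancel (by omega)]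
  rw [hL, hR, powQ_eq hM1 hMn s hη, eq_div_of_mul_eq hx.ne' (phi_mul_diagCoeff hM1 hMn hη),
    Real.rpow_sub hx, Real.rpow_one]
  field_simp

lemma left_factor_nonneg {n M i : ℕ} (hMn : M ≤ n) (σ : ℝ) {η : I n} (hη : η ∈ edgeCone n)
    (hi : i ∈ Finset.Icc 1 (M - 1)) :
    0 ≤ edgeDet η i ^ (σ - 3 / 2) * diagCoeff η (i + 1) ^ (1 - σ) := by
  rw [Finset.mem_Icc] at hi
  exact mul_nonneg (Real.rpow_nonneg (hη.2 i (by omega) (by omega)).le _)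
    (Real.rpow_nonneg (hη.1 (i + 1) (by omega) (by omega)).le _)

lemma right_factor_nonneg {n M i : ℕ} (hM1 : 1 ≤ M) (σ : ℝ) {η : I n} (hη : η ∈ edgeCone n)
    (hi : i ∈ Finset.Icc (M + 1) n) :
    0 ≤ edgeDet η (i - 1) ^ (σ - 3 / 2) * diagCoeff η (i - 1) ^ (1 - σ) := by
  rw [Finset.mem_Icc] at hi
  exact mul_nonneg (Real.rpow_nonneg (hη.2 (i - 1) (by omega) (by omega)).le _)
    (Real.rpow_nonneg (hη.1 (i - 1) (by omega) (by omega)).le _)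

lemma powQ_mul_phi_nonneg {n M : ℕ} (hM1 : 1 ≤ M) (hMn : M ≤ n) (s : Fin n → ℝ) {η : I n}
    (hη : η ∈ edgeCone n) : 0 ≤ powQ M s η * phi η := by
  rw [powQ_mul_phi_eq hM1 hMn s hη]
  exact mul_nonneg (Real.rpow_nonneg (hη.1 M hM1 hMn).le _)
    (mul_nonneg (Finset.prod_nonneg fun i hi => left_factor_nonneg hMn _ hη hi)
      (Finset.prod_nonneg fun i hi => right_factor_nonneg hM1 _ hη hi))

lemma weight_eq_ofReal {n M : ℕ} (hM1 : 1 ≤ M) (hMn : M ≤ n) (s : Fin n → ℝ) {η : I n}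
    (hη : η ∈ edgeCone n) :
    weight M s η = ENNReal.ofReal (powQ M s η * phi η) := by
  have hx : 0 < diagCoeff η M := hη.1 M hM1 hMn
  have hL := fun i (hi : i ∈ Finset.Icc 1 (M - 1)) => left_factor_nonneg hMn (at1 s i) hη hi
  have hR := fun i (hi : i ∈ Finset.Icc (M + 1) n) => right_factor_nonneg hM1 (at1 s i) hη hi
  rw [powQ_mul_phi_eq hM1 hMn s hη, ENNReal.ofReal_mul (Real.rpow_nonneg hx.le _),
    ENNReal.ofReal_mul (Finset.prod_nonneg hL), ENNReal.ofReal_prod_of_nonneg hL,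
    ENNReal.ofReal_prod_of_nonneg hR]
  unfold weight
  congr 1
  · exact if_pos hx
  · congr 1
    · refine Finset.prod_congr rfl fun i hi => ?_
      rw [Finset.mem_Icc] at hi
      have hd := hη.2 i (by omega) (by omega)
      rw [edgeDet_eq] at hd
      rw [edgeWeight, if_pos ⟨hη.1 (i + 1) (by omega) (by omega), hd⟩, edgeDet_eq]
    · refine Finset.prod_congr rfl fun i hi => ?_
      rw [Finset.mem_Icc] at hi
      have hd := hη.2 (i - 1) (by omega) (by omega)
      rw [edgeDet_eq, Nat.sub_add_cancel (by omega), mul_comm] at hd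
      rw [edgeWeight, if_pos ⟨hη.1 (i - 1) (by omega) (by omega), hd⟩, edgeDet_eq,
        Nat.sub_add_cancel (by omega), mul_comm (diagCoeff η (i - 1))]

/-! ### Schur complement of the last vertex -/

/-- The Schur complement of the last diagonal entry. For a matrix in `Z` it differs from the upper
left block in the last diagonal entry only. -/
def schurLast {n : ℕ} (y : Matrix (Fin (n + 1)) (Fin (n + 1)) ℝ) : Matrix (Fin n) (Fin n) ℝ :=
  Matrix.of fun i j => y i.castSucc j.castSucc
    - y i.castSucc (Fin.last n) * y (Fin.last n) j.castSucc / y (Fin.last n) (Fin.last n)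

lemma Z_apply_last_of_lt {n : ℕ} {y : Matrix (Fin (n + 1)) (Fin (n + 1)) ℝ} (hy : y ∈ Z (n + 1))
    {a : Fin n} (ha : a.val + 1 < n) : y a.castSucc (Fin.last n) = 0 := by
  refine hy.2 _ _ (Fin.castSucc_lt_last a).ne ?_
  rw [SimpleGraph.pathGraph_adj]
  simp only [Fin.val_castSucc, Fin.val_last]
  omega

lemma Z_apply_symm {n : ℕ} {y : Matrix (Fin n) (Fin n) ℝ} (hy : y ∈ Z n) (i j : Fin n) :
    y j i = y i j := by
  conv_rhs => rw [← hy.1]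
  rfl

lemma schurLast_mem_Z {n : ℕ} {y : Matrix (Fin (n + 1)) (Fin (n + 1)) ℝ} (hy : y ∈ Z (n + 1)) :
    schurLast y ∈ Z n := by
  constructor
  · ext i j
    simp only [schurLast, Matrix.transpose_apply, Matrix.of_apply]
    rw [Z_apply_symm hy i.castSucc j.castSucc, Z_apply_symm hy i.castSucc (Fin.last n),
      Z_apply_symm hy (Fin.last n) j.castSucc, mul_comm]
  · intro i j hij hadj
    have h1 : y i.castSucc j.castSucc = 0 := by
      refine hy.2 _ _ (by simpa using hij) ?_
      rw [SimpleGraph.pathGraph_adj] at hadj ⊢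
      simpa using hadj
    have h2 : y i.castSucc (Fin.last n) * y (Fin.last n) j.castSucc = 0 := by
      rw [Z_apply_symm hy j.castSucc (Fin.last n)]
      rcases Nat.lt_or_ge (i.val + 1) n with h | h
      · rw [Z_apply_last_of_lt hy h, zero_mul]
      · rw [Z_apply_last_of_lt hy (a := j), mul_zero]
        have := Fin.val_ne_of_ne hij
        omega
    simp [schurLast, h1, h2]

lemma schurLast_mem_P {n : ℕ} {y : Matrix (Fin (n + 1)) (Fin (n + 1)) ℝ} (hy : y ∈ P (n + 1)) :
    schurLast y ∈ P n := by
  have hZ := schurLast_mem_Z hy.1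
  have ha : 0 < y (Fin.last n) (Fin.last n) := hy.2.diag_pos
  refine ⟨hZ, Matrix.PosDef.of_dotProduct_mulVec_pos ?_ fun x hx => ?_⟩
  · rw [Matrix.IsHermitian, Matrix.conjTranspose_eq_transpose_of_trivial]
    exact hZ.1
  -- the quadratic form of the Schur complement at `x` is that of `y` at the optimal extension of `x`
  set B : ℝ := ∑ j : Fin n, y j.castSucc (Fin.last n) * x j with hB
  set t : ℝ := -B / y (Fin.last n) (Fin.last n) with ht
  have hz : (Fin.snoc x t : Fin (n + 1) → ℝ) ≠ 0 := by
    intro h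
    refine hx (funext fun i => ?_)
    have := congrFun h i.castSucc
    simpa using this
  have hpos := hy.2.dotProduct_mulVec_pos hz
  have e1 : ∑ j : Fin n, y (Fin.last n) j.castSucc * x j = B := by
    rw [hB]
    exact Finset.sum_congr rfl fun j _ => by rw [Z_apply_symm hy.1 j.castSucc]
  have e2 : ∑ i : Fin n, x i * y i.castSucc (Fin.last n) = B := by
    rw [hB]
    exact Finset.sum_congr rfl fun j _ => mul_comm _ _
  have e3 : ∑ i : Fin n, x i * ∑ j : Fin n, schurLast y i j * x j
      = ∑ i : Fin n, x i * ∑ j : Fin n, y i.castSucc j.castSucc * x j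
        - B * B / y (Fin.last n) (Fin.last n) := by
    have : ∀ i : Fin n, x i * ∑ j : Fin n, schurLast y i j * x j
        = x i * ∑ j : Fin n, y i.castSucc j.castSucc * x j
          - (x i * y i.castSucc (Fin.last n)) * (B / y (Fin.last n) (Fin.last n)) := by
      intro i
      rw [← e1, mul_assoc, ← mul_sub, Finset.sum_div]
      congr 1
      rw [Finset.mul_sum, ← Finset.sum_sub_distrib]
      refine Finset.sum_congr rfl fun j _ => ?_
      simp only [schurLast, Matrix.of_apply]
      ring
    rw [Finset.sum_congr rfl fun i _ => this i, Finset.sum_sub_distrib, ← Finset.sum_mul, e2,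
      mul_div_assoc]
  simp only [dotProduct, Matrix.mulVec, star_trivial, Fin.sum_univ_castSucc, Fin.snoc_castSucc,
    Fin.snoc_last, e1, mul_add, Finset.sum_add_distrib] at hpos
  have e4 : ∑ i : Fin n, x i * (y i.castSucc (Fin.last n) * t) = B * t := by
    rw [← e2, Finset.sum_mul]
    exact Finset.sum_congr rfl fun j _ => by ring
  simp only [dotProduct, Matrix.mulVec, star_trivial, e3]
  rw [e4] at hpos
  convert hpos using 1
  rw [ht]
  field_simp
  ring

lemma blockDet_pos {n : ℕ} {y : Matrix (Fin n) (Fin n) ℝ} (hy : y.PosDef) (i j : ℕ) :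
    0 < blockDet y i j :=
  (hy.submatrix Subtype.val_injective).det_pos

lemma det_eq_blockDet {n : ℕ} (y : Matrix (Fin n) (Fin n) ℝ) : y.det = blockDet y 1 n := by
  rw [blockDet, ← Matrix.det_submatrix_equiv_self (Equiv.subtypeUnivEquiv
    (p := fun v : Fin n => 1 ≤ v.val + 1 ∧ v.val + 1 ≤ n) fun v => ⟨by omega, by omega⟩) y]
  rfl

/-- Valid also for `i = n + 1`, where the block on the right is empty. -/
lemma blockDet_last {n i : ℕ} (hi : i ≤ n + 1) {y : Matrix (Fin (n + 1)) (Fin (n + 1)) ℝ}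
    (ha : y (Fin.last n) (Fin.last n) ≠ 0) :
    blockDet y i (n + 1) = y (Fin.last n) (Fin.last n) * blockDet (schurLast y) i n := by
  let f : {v : Fin n // i ≤ v.val + 1 ∧ v.val + 1 ≤ n} ⊕ Unit →
      {v : Fin (n + 1) // i ≤ v.val + 1 ∧ v.val + 1 ≤ n + 1} :=
    Sum.elim (fun v => ⟨v.1.castSucc, v.2.1, by simp only [Fin.val_castSucc]; omega⟩)
      (fun _ => ⟨Fin.last n, by simpa using hi, by simp⟩)
  have hf : Function.Bijective f := by
    constructor
    · rintro (⟨v, hv⟩ | _) (⟨w, hw⟩ | _) h <;>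
        simp only [f, Sum.elim_inl, Sum.elim_inr, Subtype.mk.injEq, Fin.castSucc_inj] at h
      · simp [h]
      · exact absurd h (Fin.castSucc_lt_last v).ne
      · exact absurd h (Fin.castSucc_lt_last w).ne'
      · rfl
    · rintro ⟨v, hv⟩
      refine Fin.lastCases (motive := fun v => ∀ hv, ∃ a, f a = ⟨v, hv⟩) ?_ ?_ v hv
      · exact fun _ => ⟨Sum.inr (), rfl⟩
      · exact fun w hw => ⟨Sum.inl ⟨w, hw.1, by omega⟩, rfl⟩
  let D : Matrix Unit Unit ℝ := Matrix.of fun _ _ => y (Fin.last n) (Fin.last n)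
  let _ : Invertible D :=
    ⟨Matrix.of fun _ _ => (y (Fin.last n) (Fin.last n))⁻¹,
      by ext; simp [D, Matrix.mul_apply, ha], by ext; simp [D, Matrix.mul_apply, ha]⟩
  rw [blockDet, ← Matrix.det_submatrix_equiv_self (Equiv.ofBijective f hf)]
  have hblocks : (y.toSquareBlockProp
        fun v : Fin (n + 1) => i ≤ v.val + 1 ∧ v.val + 1 ≤ n + 1).submatrix
          (Equiv.ofBijective f hf) (Equiv.ofBijective f hf)
      = Matrix.fromBlocks
          (Matrix.of fun v w => y v.1.castSucc w.1.castSucc)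
          (Matrix.of fun v _ => y v.1.castSucc (Fin.last n))
          (Matrix.of fun _ w => y (Fin.last n) w.1.castSucc) D := by
    ext (v | v) (w | w) <;> rfl
  rw [hblocks, Matrix.det_fromBlocks₂₂, blockDet]
  congr 1
  · simp [D]
  · congr 1
    ext v w
    change _ = schurLast y v.1 w.1
    simp only [schurLast, Matrix.sub_apply, Matrix.mul_apply, Matrix.of_apply,
      Finset.univ_unique, Finset.sum_singleton]
    change _ - _ * (y (Fin.last n) (Fin.last n))⁻¹ * _ = _
    ring

lemma blockDet_schurLast_of_lt {n i : ℕ} (hi : i < n)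
    {y : Matrix (Fin (n + 1)) (Fin (n + 1)) ℝ} (hy : y ∈ Z (n + 1)) :
    blockDet y 1 i = blockDet (schurLast y) 1 i := by
  let f : {v : Fin n // 1 ≤ v.val + 1 ∧ v.val + 1 ≤ i} →
      {v : Fin (n + 1) // 1 ≤ v.val + 1 ∧ v.val + 1 ≤ i} := fun v => ⟨v.1.castSucc, v.2⟩
  have hf : Function.Bijective f := by
    constructor
    · rintro ⟨v, hv⟩ ⟨w, hw⟩ h
      simpa [f] using h
    · rintro ⟨v, hv⟩
      exact ⟨⟨⟨v.val, by omega⟩, hv⟩, rfl⟩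
  rw [blockDet, ← Matrix.det_submatrix_equiv_self (Equiv.ofBijective f hf), blockDet]
  congr 1
  ext v w
  change y v.1.castSucc w.1.castSucc = schurLast y v.1 w.1
  have := v.2.2
  simp [schurLast, Z_apply_last_of_lt hy (a := v.1) (by omega)]

lemma blockDet_succ_self {n : ℕ} (y : Matrix (Fin n) (Fin n) ℝ) : blockDet y (n + 1) n = 1 := by
  have : IsEmpty {v : Fin n // n + 1 ≤ v.val + 1 ∧ v.val + 1 ≤ n} :=
    ⟨fun v => by have := v.2; omega⟩
  exact Matrix.det_isEmpty

lemma prod_rpow_sub_telescope {a : ℝ} (ha : 0 < a) (t : ℕ → ℝ) {M n : ℕ} (h : M ≤ n) :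
    ∏ i ∈ Finset.Icc (M + 1) n, a ^ (t i - t (i - 1)) = a ^ (t n - t M) := by
  induction n, h using Nat.le_induction with
  | base => simp
  | succ n hn ih =>
    rw [Finset.prod_Icc_succ_top (by omega), ih, ← Real.rpow_add ha]
    congr 1
    simp

lemma powP_eq_schurLast {n M : ℕ} (hM : 1 ≤ M) (hMn : M ≤ n) (s : Fin (n + 1) → ℝ)
    {y : Matrix (Fin (n + 1)) (Fin (n + 1)) ℝ} (hy : y ∈ P (n + 1)) :
    powP M s y = y (Fin.last n) (Fin.last n) ^ at1 s (n + 1)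
      * powP M (Fin.init s : Fin n → ℝ) (schurLast y) := by
  have ha : 0 < y (Fin.last n) (Fin.last n) := hy.2.diag_pos
  have hP := (schurLast_mem_P hy).2
  unfold powP
  rw [det_eq_blockDet, det_eq_blockDet, blockDet_last (by omega) ha.ne',
    Real.mul_rpow ha.le (blockDet_pos hP _ _).le, at1_init s hMn]
  have h1 : ∏ i ∈ Finset.Icc 1 (M - 1), blockDet y 1 i ^ (at1 s i - at1 s (i + 1))
      = ∏ i ∈ Finset.Icc 1 (M - 1), blockDet (schurLast y) 1 i
          ^ (at1 (Fin.init s : Fin n → ℝ) i - at1 (Fin.init s : Fin n → ℝ) (i + 1)) := by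
    refine Finset.prod_congr rfl fun i hi => ?_
    rw [Finset.mem_Icc] at hi
    rw [at1_init s (by omega), at1_init s (by omega), blockDet_schurLast_of_lt (by omega) hy.1]
  have h2 : ∏ i ∈ Finset.Icc (M + 1) (n + 1), blockDet y i (n + 1) ^ (at1 s i - at1 s (i - 1))
      = y (Fin.last n) (Fin.last n) ^ (at1 s (n + 1) - at1 s M)
        * ∏ i ∈ Finset.Icc (M + 1) n, blockDet (schurLast y) i n
          ^ (at1 (Fin.init s : Fin n → ℝ) i - at1 (Fin.init s : Fin n → ℝ) (i - 1)) := by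
    rw [← prod_rpow_sub_telescope ha (at1 s) (by omega : M ≤ n + 1)]
    have : ∀ i ∈ Finset.Icc (M + 1) (n + 1), blockDet y i (n + 1) ^ (at1 s i - at1 s (i - 1))
        = y (Fin.last n) (Fin.last n) ^ (at1 s i - at1 s (i - 1))
          * blockDet (schurLast y) i n ^ (at1 s i - at1 s (i - 1)) := by
      intro i hi
      rw [Finset.mem_Icc] at hi
      rw [blockDet_last hi.2 ha.ne', Real.mul_rpow ha.le (blockDet_pos hP _ _).le]
    rw [Finset.prod_congr rfl this, Finset.prod_mul_distrib]
    congr 1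
    rw [Finset.prod_Icc_succ_top (by omega), blockDet_succ_self, Real.one_rpow, mul_one]
    refine Finset.prod_congr rfl fun i hi => ?_
    rw [Finset.mem_Icc] at hi
    rw [at1_init s (by omega), at1_init s (by omega)]
  rw [h1, h2, Real.rpow_sub ha]
  have := (Real.rpow_pos_of_pos ha (at1 s M)).ne'
  field_simp

/-! ### The pairing -/

lemma pairing_eq_sum {n : ℕ} (y : Matrix (Fin n) (Fin n) ℝ) (η : I n) :
    pairing y η = ∑ i, ∑ j, y i j * toMatrix η j i := rfl

@[fun_prop]
lemma measurable_toMatrix_apply {n : ℕ} (i j : Fin n) :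
    Measurable fun η : I n => toMatrix η i j := by
  simp only [toMatrix, Matrix.of_apply]
  split_ifs
  all_goals fun_prop

@[fun_prop]
lemma measurable_pairing {n : ℕ} (y : Matrix (Fin n) (Fin n) ℝ) : Measurable (pairing y) := by
  simp only [funext (pairing_eq_sum y)]
  fun_prop

lemma toMatrix_snocI_castSucc {k : ℕ} (η : I (k + 1)) (x c : ℝ) (i j : Fin (k + 1)) :
    toMatrix (snocI η x c) i.castSucc j.castSucc = toMatrix η i j := by
  have := i.2
  have := j.2
  simp only [toMatrix, Matrix.of_apply, Fin.castSucc_inj, Fin.val_castSucc]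
  split_ifs with h1 h2 h3
  · exact diagCoeff_snocI_of_le η x c (by omega)
  · exact edgeCoeff_snocI_of_le η x c (by omega)
  · exact edgeCoeff_snocI_of_le η x c (by omega)
  · rfl

lemma toMatrix_snocI_last {k : ℕ} (η : I (k + 1)) (x c : ℝ) :
    toMatrix (snocI η x c) (Fin.last (k + 1)) (Fin.last (k + 1)) = x := by
  simp only [toMatrix, Matrix.of_apply, if_true]
  exact diagCoeff_snocI_last η x c

lemma toMatrix_snocI_castSucc_last {k : ℕ} (η : I (k + 1)) (x c : ℝ) :
    toMatrix (snocI η x c) (Fin.last k).castSucc (Fin.last (k + 1)) = c := by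
  simp only [toMatrix, Matrix.of_apply]
  rw [if_neg (Fin.castSucc_lt_last _).ne, if_pos (by simp)]
  exact edgeCoeff_snocI_last η x c

lemma toMatrix_snocI_last_castSucc {k : ℕ} (η : I (k + 1)) (x c : ℝ) :
    toMatrix (snocI η x c) (Fin.last (k + 1)) (Fin.last k).castSucc = c := by
  simp only [toMatrix, Matrix.of_apply]
  rw [if_neg (Fin.castSucc_lt_last _).ne', if_neg (by simp; omega), if_pos (by simp)]
  exact edgeCoeff_snocI_last η x c

lemma pairing_snocI {k : ℕ} {y : Matrix (Fin (k + 2)) (Fin (k + 2)) ℝ} (hy : y ∈ Z (k + 2))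
    (η : I (k + 1)) (x c : ℝ) :
    pairing y (snocI η x c)
      = pairing (schurLast y) η
        + (y (Fin.last (k + 1)) (Fin.last (k + 1)) * x
          + 2 * y (Fin.last k).castSucc (Fin.last (k + 1)) * c
          + y (Fin.last k).castSucc (Fin.last (k + 1)) ^ 2
            / y (Fin.last (k + 1)) (Fin.last (k + 1)) * diagCoeff η (k + 1)) := by
  have h0 : ∀ i : Fin k, y i.castSucc.castSucc (Fin.last (k + 1)) = 0 := fun i =>
    Z_apply_last_of_lt hy (by simp)
  have h0' : ∀ i : Fin k, y (Fin.last (k + 1)) i.castSucc.castSucc = 0 := fun i => by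
    rw [Z_apply_symm hy i.castSucc.castSucc, h0]
  have e1 : ∑ i : Fin (k + 1), y i.castSucc (Fin.last (k + 1))
        * toMatrix (snocI η x c) (Fin.last (k + 1)) i.castSucc
      = y (Fin.last k).castSucc (Fin.last (k + 1)) * c := by
    rw [Fin.sum_univ_castSucc]
    simp [h0, toMatrix_snocI_last_castSucc]
  have e2 : ∑ i : Fin (k + 1), y (Fin.last (k + 1)) i.castSucc
        * toMatrix (snocI η x c) i.castSucc (Fin.last (k + 1))
      = y (Fin.last k).castSucc (Fin.last (k + 1)) * c := by
    rw [Fin.sum_univ_castSucc]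
    simp [h0', toMatrix_snocI_castSucc_last, Z_apply_symm hy (Fin.last k).castSucc]
  have e3 : toMatrix η (Fin.last k) (Fin.last k) = diagCoeff η (k + 1) := by
    simp [toMatrix]
  have e4 : pairing (schurLast y) η
      = (∑ i : Fin (k + 1), ∑ j : Fin (k + 1), y i.castSucc j.castSucc * toMatrix η j i)
        - y (Fin.last k).castSucc (Fin.last (k + 1)) ^ 2
            / y (Fin.last (k + 1)) (Fin.last (k + 1)) * diagCoeff η (k + 1) := by
    simp only [pairing_eq_sum, schurLast, Matrix.of_apply, sub_mul, Finset.sum_sub_distrib]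
    congr 1
    rw [Fin.sum_univ_castSucc]
    simp only [h0, zero_mul, zero_div, Finset.sum_const_zero, zero_add]
    rw [Fin.sum_univ_castSucc]
    simp only [h0', mul_zero, zero_mul, zero_div, Finset.sum_const_zero, zero_add, e3,
      Z_apply_symm hy (Fin.last k).castSucc (Fin.last (k + 1))]
    ring
  rw [e4, pairing_eq_sum, Fin.sum_univ_castSucc]
  simp only [Fin.sum_univ_castSucc (n := k + 1), toMatrix_snocI_castSucc, toMatrix_snocI_last,
    Finset.sum_add_distrib, e1, e2]
  ring

/-! ### Reflection of the path -/

/-- The incomplete matrix `η` with the order of the vertices reversed. -/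
def revI {n : ℕ} (η : I n) : I n := (η.1 ∘ Fin.rev, η.2 ∘ Fin.rev)

lemma at1_comp_rev {n : ℕ} (v : Fin n → ℝ) {i : ℕ} (hi : i ≤ n + 1) :
    at1 (v ∘ Fin.rev) i = at1 v (n + 1 - i) := by
  unfold at1
  by_cases h : 1 ≤ i ∧ i ≤ n
  · rw [dif_pos h, dif_pos (by omega)]
    simp only [Function.comp_apply]
    congr 1
    ext
    simp only [Fin.val_rev]
    omega
  · rw [dif_neg h, dif_neg (by omega)]

lemma diagCoeff_revI {n : ℕ} (η : I n) {i : ℕ} (hi : i ≤ n + 1) :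
    diagCoeff (revI η) i = diagCoeff η (n + 1 - i) :=
  at1_comp_rev η.1 hi

lemma edgeCoeff_revI {n : ℕ} (η : I n) {i : ℕ} (h1 : 1 ≤ n) (hi : i ≤ n) :
    edgeCoeff (revI η) i = edgeCoeff η (n - i) := by
  have := at1_comp_rev η.2 (i := i) (by omega)
  rwa [Nat.sub_add_cancel h1] at this

lemma prod_Icc_reflect {R : Type*} [CommMonoid R] {n a b : ℕ} (ha : 1 ≤ a) (hb : b ≤ n)
    (g : ℕ → R) :
    ∏ i ∈ Finset.Icc a b, g (n + 1 - i) = ∏ i ∈ Finset.Icc (n + 1 - b) (n + 1 - a), g i := by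
  refine Finset.prod_nbij' (n + 1 - ·) (n + 1 - ·) ?_ ?_ ?_ ?_ (fun _ _ => rfl) <;>
  · intro i hi
    simp only [Finset.mem_Icc] at *
    omega

lemma weight_revI {n M : ℕ} (hM1 : 1 ≤ M) (hMn : M ≤ n) (s : Fin n → ℝ) (η : I n) :
    weight (n + 1 - M) (s ∘ Fin.rev) (revI η) = weight M s η := by
  have hM : n + 1 - (n + 1 - M) = M := by omega
  unfold weight
  rw [at1_comp_rev s (by omega), diagCoeff_revI η (by omega), hM]
  congr 1
  rw [mul_comm]
  congr 1
  · rw [show Finset.Icc 1 (M - 1) = Finset.Icc (n + 1 - n) (n + 1 - (n + 1 - M + 1)) by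
        congr 1 <;> omega, ← prod_Icc_reflect (by omega) le_rfl
        (fun i => edgeWeight (at1 s i) (diagCoeff η i) (diagCoeff η (i + 1)) (edgeCoeff η i))]
    refine Finset.prod_congr rfl fun i hi => ?_
    rw [Finset.mem_Icc] at hi
    rw [at1_comp_rev s (by omega), diagCoeff_revI η (by omega), diagCoeff_revI η (by omega),
      edgeCoeff_revI η (by omega) (by omega), show n + 1 - (i - 1) = n + 1 - i + 1 by omega,
      show n - (i - 1) = n + 1 - i by omega]
  · rw [show Finset.Icc (M + 1) n = Finset.Icc (n + 1 - (n + 1 - M - 1)) (n + 1 - 1) by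
        congr 1; omega, ← prod_Icc_reflect le_rfl (by omega)
        (fun i => edgeWeight (at1 s i) (diagCoeff η i) (diagCoeff η (i - 1))
          (edgeCoeff η (i - 1)))]
    refine Finset.prod_congr rfl fun i hi => ?_
    rw [Finset.mem_Icc] at hi
    rw [at1_comp_rev s (by omega), diagCoeff_revI η (by omega), diagCoeff_revI η (by omega),
      edgeCoeff_revI η (by omega) (by omega), show n + 1 - (i + 1) = n + 1 - i - 1 by omega,
      show n - i = n + 1 - i - 1 by omega]

lemma toMatrix_revI {n : ℕ} (η : I n) (i j : Fin n) :
    toMatrix (revI η) i.rev j.rev = toMatrix η i j := by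
  have hi := i.2
  have hj := j.2
  simp only [toMatrix, Matrix.of_apply, Fin.rev_inj, Fin.val_rev]
  by_cases h : i = j
  · rw [if_pos h, if_pos h, diagCoeff_revI η (by omega)]
    congr 1
    omega
  · have h' : i.val ≠ j.val := Fin.val_ne_of_ne h
    rw [if_neg h, if_neg h]
    by_cases h1 : i.val + 1 = j.val
    · rw [if_neg (by omega), if_pos (by omega), if_pos h1, edgeCoeff_revI η (by omega) (by omega)]
      congr 1
      omega
    · rw [if_neg h1]
      by_cases h2 : j.val + 1 = i.val
      · rw [if_pos (by omega), if_pos h2, edgeCoeff_revI η (by omega) (by omega)]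
        congr 1
        omega
      · rw [if_neg (by omega), if_neg (by omega), if_neg h2]

lemma pairing_revI {n : ℕ} (y : Matrix (Fin n) (Fin n) ℝ) (η : I n) :
    pairing (y.submatrix Fin.rev Fin.rev) (revI η) = pairing y η := by
  rw [pairing_eq_sum, pairing_eq_sum, ← Equiv.sum_comp Fin.revPerm]
  refine Finset.sum_congr rfl fun i _ => ?_
  rw [← Equiv.sum_comp Fin.revPerm]
  refine Finset.sum_congr rfl fun j _ => ?_
  simp [toMatrix_revI]

lemma submatrix_rev_mem_P {n : ℕ} {y : Matrix (Fin n) (Fin n) ℝ} (hy : y ∈ P n) :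
    y.submatrix Fin.rev Fin.rev ∈ P n := by
  refine ⟨⟨?_, fun i j hij hadj => ?_⟩, hy.2.submatrix Fin.rev_injective⟩
  · exact hy.1.1.submatrix _
  · refine hy.1.2 _ _ (by simpa using hij) ?_
    rw [SimpleGraph.pathGraph_adj] at hadj ⊢
    simp only [Fin.val_rev]
    omega

lemma blockDet_submatrix_rev {n i j : ℕ} (hi : i ≤ n + 1) (hj : j ≤ n + 1)
    (y : Matrix (Fin n) (Fin n) ℝ) :
    blockDet (y.submatrix Fin.rev Fin.rev) i j = blockDet y (n + 1 - j) (n + 1 - i) := by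
  let e : {v : Fin n // i ≤ v.val + 1 ∧ v.val + 1 ≤ j} ≃
      {v : Fin n // n + 1 - j ≤ v.val + 1 ∧ v.val + 1 ≤ n + 1 - i} :=
    Fin.revPerm.subtypeEquiv fun v => by
      simp only [Fin.revPerm_apply, Fin.val_rev]
      omega
  rw [blockDet, blockDet, ← Matrix.det_submatrix_equiv_self e]
  rfl

lemma powP_rev {n M : ℕ} (hM1 : 1 ≤ M) (hMn : M ≤ n) (s : Fin n → ℝ)
    (y : Matrix (Fin n) (Fin n) ℝ) :
    powP (n + 1 - M) (s ∘ Fin.rev) (y.submatrix Fin.rev Fin.rev) = powP M s y := by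
  have hM : n + 1 - (n + 1 - M) = M := by omega
  unfold powP
  rw [at1_comp_rev s (by omega), hM,
    show (y.submatrix Fin.rev Fin.rev).det = y.det from
      Matrix.det_submatrix_equiv_self Fin.revPerm y]
  rw [mul_comm, mul_comm _ (y.det ^ _), ← mul_assoc]
  congr 1
  · congr 1
    rw [show Finset.Icc 1 (M - 1) = Finset.Icc (n + 1 - n) (n + 1 - (n + 1 - M + 1)) by
        congr 1 <;> omega, ← prod_Icc_reflect (by omega) le_rfl
        (fun i => blockDet y 1 i ^ (at1 s i - at1 s (i + 1)))]
    refine Finset.prod_congr rfl fun i hi => ?_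
    rw [Finset.mem_Icc] at hi
    rw [at1_comp_rev s (by omega), at1_comp_rev s (by omega),
      blockDet_submatrix_rev (by omega) (by omega), show n + 1 - (i - 1) = n + 1 - i + 1 by omega,
      Nat.add_sub_cancel_left]
  · rw [show Finset.Icc (M + 1) n = Finset.Icc (n + 1 - (n + 1 - M - 1)) (n + 1 - 1) by
        congr 1; omega, ← prod_Icc_reflect le_rfl (by omega)
        (fun i => blockDet y i n ^ (at1 s i - at1 s (i - 1)))]
    refine Finset.prod_congr rfl fun i hi => ?_
    rw [Finset.mem_Icc] at hi
    rw [at1_comp_rev s (by omega), at1_comp_rev s (by omega),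
      blockDet_submatrix_rev (by omega) (by omega), show n + 1 - (i + 1) = n + 1 - i - 1 by omega,
      Nat.add_sub_cancel]

lemma lintegral_revI {n : ℕ} (f : I n → ℝ≥0∞) : ∫⁻ η, f (revI η) = ∫⁻ η, f η := by
  let e : I n ≃ᵐ I n := MeasurableEquiv.prodCongr
    (MeasurableEquiv.arrowCongr' Fin.revPerm (MeasurableEquiv.refl ℝ))
    (MeasurableEquiv.arrowCongr' Fin.revPerm (MeasurableEquiv.refl ℝ))
  have he : MeasurePreserving e volume volume :=
    (volume_preserving_arrowCongr' Fin.revPerm _ (MeasurePreserving.id _)).prod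
      (volume_preserving_arrowCongr' Fin.revPerm _ (MeasurePreserving.id _))
  exact he.lintegral_comp_emb e.measurableEmbedding f

/-! ### The integral in `[0, ∞]` -/

/-- The Laplace transform at `y` of the function `weight M s`, with values in `[0, ∞]`. -/
def laplace {n : ℕ} (M : ℕ) (s : Fin n → ℝ) (y : Matrix (Fin n) (Fin n) ℝ) : ℝ≥0∞ :=
  ∫⁻ η : I n, weight M s η * ENNReal.ofReal (Real.exp (-pairing y η))

lemma laplace_rev {n M : ℕ} (hM1 : 1 ≤ M) (hMn : M ≤ n) (s : Fin n → ℝ)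
    (y : Matrix (Fin n) (Fin n) ℝ) :
    laplace (n + 1 - M) (s ∘ Fin.rev) (y.submatrix Fin.rev Fin.rev) = laplace M s y := by
  rw [laplace, ← lintegral_revI]
  simp only [weight_revI hM1 hMn, pairing_revI]
  rfl

lemma laplace_eq_schurLast {k M : ℕ} (hM1 : 1 ≤ M) (hMk : M ≤ k + 1) (s : Fin (k + 2) → ℝ)
    {y : Matrix (Fin (k + 2)) (Fin (k + 2)) ℝ} (hy : y ∈ P (k + 2)) :
    laplace M s y
      = laplace M (Fin.init s : Fin (k + 1) → ℝ) (schurLast y)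
        * (ENNReal.ofReal √Real.pi * gammaENN (at1 s (k + 2) - 1 / 2)
          * ENNReal.ofReal (y (Fin.last (k + 1)) (Fin.last (k + 1)) ^ (-at1 s (k + 2)))) := by
  have ha : 0 < y (Fin.last (k + 1)) (Fin.last (k + 1)) := hy.2.diag_pos
  unfold laplace
  rw [lintegral_snocI (by fun_prop), ← lintegral_mul_const _ (by fun_prop)]
  refine lintegral_congr fun η => ?_
  by_cases hw : weight M (Fin.init s : Fin (k + 1) → ℝ) η = 0
  · simp [weight_snocI hMk, hw]
  · have hη := mem_edgeCone_of_weight_ne_zero hw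
    have hne : weight M (Fin.init s : Fin (k + 1) → ℝ) η
        * ENNReal.ofReal (Real.exp (-pairing (schurLast y) η)) ≠ ⊤ := by
      rw [weight_eq_ofReal hM1 hMk _ hη]
      exact ENNReal.mul_ne_top ENNReal.ofReal_ne_top ENNReal.ofReal_ne_top
    rw [← lintegral_leaf ha (hη.1 (k + 1) (by omega) le_rfl) (at1 s (k + 2))
      (y (Fin.last k).castSucc (Fin.last (k + 1))), ← lintegral_const_mul' _ _ hne]
    refine lintegral_congr fun c => ?_
    rw [← lintegral_const_mul' _ _ hne]
    refine lintegral_congr fun x => ?_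
    rw [weight_snocI hMk, pairing_snocI hy.1, neg_add, Real.exp_add,
      ENNReal.ofReal_mul (Real.exp_pos _).le]
    ring

lemma lintegral_I_one {f : I 1 → ℝ≥0∞} (hf : Measurable f) :
    ∫⁻ η, f η = ∫⁻ x : ℝ, f ((fun _ => x), default) := by
  have h0 : ∀ g : (Fin (1 - 1) → ℝ) → ℝ≥0∞, ∫⁻ w, g w = g default := by
    intro g
    change ∫⁻ w : Fin 0 → ℝ, g w = g default
    rw [Measure.volume_pi_eq_dirac default, lintegral_dirac]
  rw [Measure.volume_eq_prod, lintegral_prod _ hf.aemeasurable]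
  simp only [h0]
  exact ((volume_preserving_funUnique (Fin 1) ℝ).symm.lintegral_comp_emb
    (MeasurableEquiv.measurableEmbedding _) fun v => f (v, default)).symm

lemma laplace_one (s : Fin 1 → ℝ) {y : Matrix (Fin 1) (Fin 1) ℝ} (hy : y ∈ P 1) :
    laplace 1 s y = gammaENN (at1 s 1) * ENNReal.ofReal (powP 1 (-s) y) := by
  have ha : 0 < y 0 0 := hy.2.diag_pos
  have hp : powP 1 (-s) y = y 0 0 ^ (-at1 s 1) := by
    simp [powP, at1]
  rw [hp, ← lintegral_rpow_mul_exp_neg_mul ha, laplace, lintegral_I_one (by fun_prop),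
    ← lintegral_indicator measurableSet_Ioi]
  refine lintegral_congr fun x => ?_
  have hx : diagCoeff (n := 1) ((fun _ => x), default) 1 = x := by simp [diagCoeff, at1]
  have hpair : pairing y ((fun _ => x), default) = y 0 0 * x := by
    rw [pairing_eq_sum]
    simp [toMatrix, diagCoeff, at1]
  simp only [weight, hx, hpair, rootWeight, indicator, mem_Ioi]
  split_ifs with h
  · simp [ENNReal.ofReal_mul (Real.rpow_nonneg h.le _)]
  · simp

/-- The gamma factors of the integral, with values in `[0, ∞]`. -/
def gammaFactor {n : ℕ} (M : ℕ) (s : Fin n → ℝ) : ℝ≥0∞ :=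
  ENNReal.ofReal √Real.pi ^ (n - 1)
    * (∏ i ∈ (Finset.Icc 1 n).erase M, gammaENN (at1 s i - 1 / 2)) * gammaENN (at1 s M)

lemma gammaFactor_rev {n M : ℕ} (hM1 : 1 ≤ M) (hMn : M ≤ n) (s : Fin n → ℝ) :
    gammaFactor (n + 1 - M) (s ∘ Fin.rev) = gammaFactor M s := by
  have hM : n + 1 - (n + 1 - M) = M := by omega
  unfold gammaFactor
  rw [at1_comp_rev s (by omega), hM]
  congr 2
  refine Finset.prod_nbij' (n + 1 - ·) (n + 1 - ·) ?_ ?_ ?_ ?_ ?_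
  all_goals
    intro i hi
    simp only [Finset.mem_erase, Finset.mem_Icc] at *
  · omega
  · omega
  · omega
  · omega
  · rw [at1_comp_rev s (by omega)]

lemma gammaFactor_eq_init {k M : ℕ} (hMk : M ≤ k + 1) (s : Fin (k + 2) → ℝ) :
    gammaFactor M s = gammaFactor M (Fin.init s : Fin (k + 1) → ℝ)
      * (ENNReal.ofReal √Real.pi * gammaENN (at1 s (k + 2) - 1 / 2)) := by
  have hset : (Finset.Icc 1 (k + 2)).erase M
      = insert (k + 2) ((Finset.Icc 1 (k + 1)).erase M) := by
    ext i
    simp only [Finset.mem_insert, Finset.mem_erase, Finset.mem_Icc]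
    omega
  unfold gammaFactor
  rw [hset, Finset.prod_insert (by simp), at1_init s hMk,
    Finset.prod_congr rfl fun i hi => by
      rw [← at1_init s (Finset.mem_Icc.1 (Finset.mem_of_mem_erase hi)).2]]
  simp only [Nat.add_sub_cancel, Nat.reduceSubDiff, pow_succ]
  ring

/-- The integral formula in `[0, ∞]`. The last vertex is removed when it is not the root; when it
is, reflecting the path makes it the first one. -/
lemma laplace_eq {k M : ℕ} (hM1 : 1 ≤ M) (hMk : M ≤ k + 1) (s : Fin (k + 1) → ℝ)
    {y : Matrix (Fin (k + 1)) (Fin (k + 1)) ℝ} (hy : y ∈ P (k + 1)) :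
    laplace M s y = gammaFactor M s * ENNReal.ofReal (powP M (-s) y) := by
  induction k generalizing M with
  | zero =>
    obtain rfl : M = 1 := by omega
    simp [laplace_one s hy, gammaFactor]
  | succ k ih =>
    have step : ∀ {M : ℕ} (_ : 1 ≤ M) (_ : M ≤ k + 1) (s : Fin (k + 2) → ℝ)
        {y : Matrix (Fin (k + 2)) (Fin (k + 2)) ℝ} (_ : y ∈ P (k + 2)),
        laplace M s y = gammaFactor M s * ENNReal.ofReal (powP M (-s) y) := by
      intro M hM1 hMk s y hy
      have ha : 0 < y (Fin.last (k + 1)) (Fin.last (k + 1)) := hy.2.diag_pos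
      have hneg : at1 (-s) (k + 2) = -at1 s (k + 2) := by simp [at1]
      rw [laplace_eq_schurLast hM1 hMk s hy, ih hM1 hMk _ (schurLast_mem_P hy),
        gammaFactor_eq_init hMk, powP_eq_schurLast hM1 hMk _ hy,
        ENNReal.ofReal_mul (Real.rpow_nonneg ha.le _), hneg]
      have : (Fin.init (-s) : Fin (k + 1) → ℝ) = -(Fin.init s : Fin (k + 1) → ℝ) := rfl
      rw [this]
      ring
    rcases Nat.lt_or_ge M (k + 2) with h | h
    · exact step hM1 (by omega) s hy
    · rw [← laplace_rev hM1 hMk, step (by omega) (by omega) _ (submatrix_rev_mem_P hy),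
        gammaFactor_rev hM1 hMk]
      congr 2
      exact powP_rev hM1 hMk (-s) y

/-! ### The dual cone -/

lemma exists_eq_snocI {k : ℕ} (η : I (k + 2)) : ∃ (η' : I (k + 1)) (x c : ℝ), η = snocI η' x c :=
  ⟨((Fin.init η.1 : Fin (k + 1) → ℝ), (Fin.init (n := k) η.2 : Fin k → ℝ)), η.1 (Fin.last (k + 1)),
    η.2 (Fin.last k), Prod.ext (Fin.snoc_init_self η.1).symm
      (Fin.snoc_init_self (n := k) η.2).symm⟩

lemma snocI_mem_edgeCone {k : ℕ} {η : I (k + 1)} {x c : ℝ}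
    (h : snocI η x c ∈ edgeCone (k + 2)) :
    η ∈ edgeCone (k + 1) ∧ 0 < x * diagCoeff η (k + 1) - c ^ 2 := by
  refine ⟨⟨fun i h1 hi => ?_, fun i h1 hi => ?_⟩, ?_⟩
  · rw [← diagCoeff_snocI_of_le η x c hi]
    exact h.1 i h1 (by omega)
  · have := h.2 i h1 (by omega)
    rwa [edgeDet_eq, diagCoeff_snocI_of_le η x c (by omega), diagCoeff_snocI_of_le η x c (by omega),
      edgeCoeff_snocI_of_le η x c (by omega), ← edgeDet_eq] at this
  · have := h.2 (k + 1) (by omega) (by omega)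
    rwa [edgeDet_eq, diagCoeff_snocI_of_le η x c le_rfl, diagCoeff_snocI_last,
      edgeCoeff_snocI_last, mul_comm] at this

/-- By induction on the number of vertices: the terms of the pairing that involve the last one,
together with the correction from the Schur complement, are a multiple of the last edge determinant
plus a square, and both are nonnegative. -/
lemma pairing_nonneg_of_mem_P {k : ℕ} {y : Matrix (Fin (k + 1)) (Fin (k + 1)) ℝ}
    (hy : y ∈ P (k + 1)) {η : I (k + 1)} (hη : η ∈ edgeCone (k + 1)) : 0 ≤ pairing y η := by
  induction k with
  | zero =>
    have h : pairing y η = y 0 0 * diagCoeff η 1 := by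
      rw [pairing_eq_sum]
      simp [toMatrix]
    rw [h]
    exact mul_nonneg hy.2.diag_pos.le (hη.1 1 le_rfl le_rfl).le
  | succ k ih =>
    obtain ⟨η', x, c, rfl⟩ := exists_eq_snocI η
    obtain ⟨hη', hd⟩ := snocI_mem_edgeCone hη
    rw [pairing_snocI hy.1]
    refine add_nonneg (ih (schurLast_mem_P hy) hη') ?_
    have ha : 0 < y (Fin.last (k + 1)) (Fin.last (k + 1)) := hy.2.diag_pos
    have hp : 0 < diagCoeff η' (k + 1) := hη'.1 (k + 1) (by omega) le_rfl
    generalize y (Fin.last (k + 1)) (Fin.last (k + 1)) = a at ha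
    generalize y (Fin.last k).castSucc (Fin.last (k + 1)) = b
    generalize diagCoeff η' (k + 1) = p at hd hp
    rw [show a * x + 2 * b * c + b ^ 2 / a * p
      = a * (x * p - c ^ 2) / p + a / p * (c + b * p / a) ^ 2 by field_simp; ring]
    positivity

lemma continuous_pairing_left {n : ℕ} (η : I n) : Continuous fun y => pairing y η := by
  unfold pairing
  fun_prop

lemma isClosed_Z (n : ℕ) : IsClosed (Z n) := by
  have : Z n = {y | y.transpose = y} ∩
      ⋂ i, ⋂ j, {y | i ≠ j → ¬ (SimpleGraph.pathGraph n).Adj i j → y i j = 0} := by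
    ext y
    simp [Z, Matrix.IsSymm]
  rw [this]
  refine (isClosed_eq (by fun_prop) continuous_id).inter
    (isClosed_iInter fun i => isClosed_iInter fun j => ?_)
  by_cases h : i ≠ j ∧ ¬ (SimpleGraph.pathGraph n).Adj i j
  · simp only [h.1, h.2, ne_eq, not_false_eq_true, true_imp_iff]
    exact isClosed_eq (by fun_prop) continuous_const
  · convert isClosed_univ
    ext y
    simp only [mem_ofPred_eq, mem_univ, iff_true]
    exact fun h1 h2 => absurd ⟨h1, h2⟩ h

lemma continuous_diagCoeff {n : ℕ} (i : ℕ) : Continuous fun η : I n => diagCoeff η i := by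
  unfold diagCoeff at1
  split_ifs <;> fun_prop

lemma continuous_edgeCoeff {n : ℕ} (i : ℕ) : Continuous fun η : I n => edgeCoeff η i := by
  unfold edgeCoeff at1
  split_ifs <;> fun_prop

lemma isOpen_edgeCone (n : ℕ) : IsOpen (edgeCone n) := by
  have : edgeCone n = (⋂ i ∈ Finset.Icc 1 n, {η | 0 < diagCoeff η i}) ∩
      ⋂ i ∈ Finset.Ico 1 n, {η | 0 < edgeDet η i} := by
    ext η
    simp [edgeCone]
  rw [this]
  refine (isOpen_biInter_finset fun i _ => ?_).inter (isOpen_biInter_finset fun i _ => ?_)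
  · exact isOpen_lt continuous_const (continuous_diagCoeff i)
  · simp only [edgeDet_eq]
    exact isOpen_lt continuous_const (((continuous_diagCoeff i).mul
      (continuous_diagCoeff (i + 1))).sub ((continuous_edgeCoeff i).pow 2))

/-- The coefficients of `y` on the diagonal and on the edges of the path. -/
def coeffs {n : ℕ} (y : Matrix (Fin n) (Fin n) ℝ) : I n :=
  (fun i => y i i, fun i => y ⟨i.val, by omega⟩ ⟨i.val + 1, by omega⟩)

lemma toMatrix_coeffs {n : ℕ} {y : Matrix (Fin n) (Fin n) ℝ} (hy : y ∈ Z n) :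
    toMatrix (coeffs y) = y := by
  ext i j
  have hi := i.2
  have hj := j.2
  simp only [toMatrix, Matrix.of_apply]
  split_ifs with h1 h2 h3
  · subst h1
    exact at1_fin _ i
  · rw [edgeCoeff, at1, dif_pos (by omega)]
    simp only [coeffs]
    congr 1
    ext
    simpa using h2
  · rw [edgeCoeff, at1, dif_pos (by omega), ← Z_apply_symm hy]
    simp only [coeffs]
    congr 1
    ext
    simpa using h3
  · refine (hy.2 i j h1 ?_).symm
    rw [SimpleGraph.pathGraph_adj]
    omega

lemma at1_sub_smul {n : ℕ} (v w : Fin n → ℝ) (ε : ℝ) (i : ℕ) :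
    at1 (v - ε • w) i = at1 v i - ε * at1 w i := by
  unfold at1
  split_ifs <;> simp

lemma toMatrix_sub_smul {n : ℕ} (η ζ : I n) (ε : ℝ) :
    toMatrix (η - ε • ζ) = toMatrix η - ε • toMatrix ζ := by
  ext i j
  simp only [toMatrix, Matrix.of_apply, Matrix.sub_apply, Matrix.smul_apply, smul_eq_mul,
    diagCoeff, edgeCoeff, Prod.fst_sub, Prod.snd_sub, Prod.smul_fst, Prod.smul_snd, at1_sub_smul]
  split_ifs <;> simp

lemma edgeCone_subset_Q (k : ℕ) : edgeCone (k + 1) ⊆ Q (k + 1) := by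
  rintro η hη y ⟨hy, hy0⟩
  have hnonneg : ∀ ζ ∈ edgeCone (k + 1), 0 ≤ pairing y ζ := fun ζ hζ =>
    closure_minimal (fun y hy => pairing_nonneg_of_mem_P hy hζ)
      (isClosed_le continuous_const (continuous_pairing_left ζ)) hy
  have hZ : y ∈ Z (k + 1) := closure_minimal (fun y hy => hy.1) (isClosed_Z _) hy
  -- the cone is open, so `η` can be moved a little in the direction in which the pairing decreases
  have hev : ∀ᶠ ε : ℝ in nhdsWithin 0 (Ioi 0), η - ε • coeffs y ∈ edgeCone (k + 1) := by
    have hc : Continuous fun ε : ℝ => η - ε • coeffs y := by fun_prop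
    refine (hc.tendsto' 0 η (by simp)).mono_left nhdsWithin_le_nhds |>.eventually ?_
    exact (isOpen_edgeCone _).mem_nhds hη
  obtain ⟨ε, hε, hε0⟩ := (hev.and self_mem_nhdsWithin).exists
  have h1 := hnonneg _ hε
  have h2 : 0 < (y * y).trace := by
    refine lt_of_le_of_ne ?_ fun h => hy0 ?_
    · have := (Matrix.posSemidef_conjTranspose_mul_self y).trace_nonneg
      rwa [Matrix.conjTranspose_eq_transpose_of_trivial, hZ.1] at this
    · rw [mem_singleton_iff, ← Matrix.trace_conjTranspose_mul_self_eq_zero_iff,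
        Matrix.conjTranspose_eq_transpose_of_trivial, hZ.1]
      exact h.symm
  rw [pairing, toMatrix_sub_smul, toMatrix_coeffs hZ, Matrix.mul_sub, Matrix.trace_sub,
    Matrix.mul_smul, Matrix.trace_smul, smul_eq_mul, sub_nonneg] at h1
  exact (mul_pos hε0 h2).trans_le h1

lemma vecMulVec_mem_closure_P {n : ℕ} {a b : Fin n}
    (hab : a = b ∨ (SimpleGraph.pathGraph n).Adj a b) (u w : ℝ) :
    Matrix.vecMulVec (Pi.single a u + Pi.single b w : Fin n → ℝ) (Pi.single a u + Pi.single b w)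
      ∈ closure (P n) := by
  set v : Fin n → ℝ := Pi.single a u + Pi.single b w with hv
  have hc : Continuous fun ε : ℝ => Matrix.vecMulVec v v + ε • (1 : Matrix (Fin n) (Fin n) ℝ) := by
    fun_prop
  refine mem_closure_of_tendsto
    ((hc.tendsto' 0 (Matrix.vecMulVec v v) (by simp)).mono_left
      (nhdsWithin_le_nhds (s := Ioi (0 : ℝ)))) ?_
  filter_upwards [self_mem_nhdsWithin] with ε hε
  refine ⟨⟨?_, fun i j hij hadj => ?_⟩, ?_⟩
  · ext i j
    simp [Matrix.vecMulVec_apply, mul_comm, Matrix.one_apply, eq_comm]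
  · have h0 : v i * v j = 0 := by
      simp only [hv, Pi.add_apply, Pi.single_apply]
      rcases hab with rfl | hab
      · by_cases h : i = a
        · subst h; simp [hij.symm]
        · simp [h]
      · by_cases h1 : i = a <;> by_cases h2 : j = b <;> by_cases h3 : i = b <;>
          by_cases h4 : j = a <;> simp_all [SimpleGraph.adj_comm]
    simp [Matrix.vecMulVec_apply, h0, hij]
  · refine Matrix.PosDef.posSemidef_add ?_ (Matrix.PosDef.one.smul hε)
    simpa using Matrix.posSemidef_vecMulVec_self_star v

lemma pairing_vecMulVec {n : ℕ} (a b : Fin n) (u w : ℝ) (η : I n) :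
    pairing (Matrix.vecMulVec (Pi.single a u + Pi.single b w : Fin n → ℝ)
        (Pi.single a u + Pi.single b w)) η
      = u ^ 2 * toMatrix η a a + u * w * toMatrix η a b + u * w * toMatrix η b a
        + w ^ 2 * toMatrix η b b := by
  rw [pairing_eq_sum]
  simp only [Matrix.vecMulVec_apply, Pi.add_apply, Pi.single_apply, add_mul, mul_add,
    Finset.sum_add_distrib, ite_mul, mul_ite, zero_mul, mul_zero, Finset.sum_ite_eq',
    Finset.mem_univ, if_true]
  ring

/-- The rank one matrices supported on one edge test the positivity of its determinant. -/
lemma Q_subset_edgeCone (n : ℕ) : Q n ⊆ edgeCone n := by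
  intro η hη
  have hdiag : ∀ i, 1 ≤ i → i ≤ n → 0 < diagCoeff η i := by
    intro i h1 hi
    let a : Fin n := ⟨i - 1, by omega⟩
    have h := hη _ ⟨vecMulVec_mem_closure_P (a := a) (b := a) (Or.inl rfl) 1 0, fun h0 => by
      have := congrFun (congrFun h0 a) a
      simp [Matrix.vecMulVec_apply] at this⟩
    rw [pairing_vecMulVec] at h
    simpa [toMatrix, a, Nat.sub_add_cancel h1] using h
  refine ⟨hdiag, fun i h1 hi => ?_⟩
  let a : Fin n := ⟨i - 1, by omega⟩
  let b : Fin n := ⟨i, hi⟩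
  have hab : a ≠ b := Fin.ne_of_val_ne (by simp only [a, b]; omega)
  have hp := hdiag (i + 1) (by omega) hi
  have h := hη _ ⟨vecMulVec_mem_closure_P (a := a) (b := b) (Or.inr (by
    rw [SimpleGraph.pathGraph_adj]; simp only [a, b]; omega))
    (diagCoeff η (i + 1)) (-edgeCoeff η i), fun h0 => by
      have := congrFun (congrFun h0 a) a
      simp [Matrix.vecMulVec_apply, hab, hp.ne'] at this⟩
  have e1 : toMatrix η a a = diagCoeff η i := by simp [toMatrix, a, Nat.sub_add_cancel h1]
  have e2 : toMatrix η b b = diagCoeff η (i + 1) := by simp [toMatrix, b]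
  have e3 : toMatrix η a b = edgeCoeff η i := by
    rw [toMatrix, Matrix.of_apply, if_neg hab]
    simp [a, b, Nat.sub_add_cancel h1]
  have e4 : toMatrix η b a = edgeCoeff η i := by
    rw [toMatrix, Matrix.of_apply, if_neg hab.symm,
      if_neg (by simp only [a, b]; omega), if_pos (by simp only [a, b]; omega)]
    simp [a, Nat.sub_add_cancel h1]
  rw [pairing_vecMulVec, e1, e2, e3, e4] at h
  rw [edgeDet_eq]
  refine pos_of_mul_pos_right (a := diagCoeff η (i + 1)) ?_ hp.le
  linarith

lemma Q_eq_edgeCone (k : ℕ) : Q (k + 1) = edgeCone (k + 1) :=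
  (Q_subset_edgeCone _).antisymm (edgeCone_subset_Q k)

/-! ### Convergence and value of the integral -/

lemma measurable_integrand {n : ℕ} (M : ℕ) (s : Fin n → ℝ) (y : Matrix (Fin n) (Fin n) ℝ) :
    Measurable (integrand M s y) := by
  unfold integrand powQ phi
  simp only [edgeDet_eq]
  split_ifs <;> fun_prop

lemma setLIntegral_integrand {k M : ℕ} (hM1 : 1 ≤ M) (hMk : M ≤ k + 1) (s : Fin (k + 1) → ℝ)
    (y : Matrix (Fin (k + 1)) (Fin (k + 1)) ℝ) :
    ∫⁻ η in Q (k + 1), ENNReal.ofReal (integrand M s y η) = laplace M s y := by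
  rw [Q_eq_edgeCone, ← lintegral_indicator (isOpen_edgeCone _).measurableSet, laplace]
  refine lintegral_congr fun η => ?_
  by_cases hη : η ∈ edgeCone (k + 1)
  · rw [indicator_of_mem hη, weight_eq_ofReal hM1 hMk s hη, integrand, mul_assoc,
      ENNReal.ofReal_mul (Real.exp_pos _).le, mul_comm]
  · rw [indicator_of_notMem hη]
    by_contra h
    refine hη (mem_edgeCone_of_weight_ne_zero (M := M) (s := s) fun h0 => h ?_)
    rw [h0, zero_mul]

lemma integrand_nonneg {k M : ℕ} (hM1 : 1 ≤ M) (hMk : M ≤ k + 1) (s : Fin (k + 1) → ℝ)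
    (y : Matrix (Fin (k + 1)) (Fin (k + 1)) ℝ) :
    0 ≤ᵐ[volume.restrict (Q (k + 1))] integrand M s y := by
  rw [Q_eq_edgeCone]
  refine (ae_restrict_iff' (isOpen_edgeCone _).measurableSet).2 (ae_of_all _ fun η hη => ?_)
  rw [integrand, mul_assoc]
  exact mul_nonneg (Real.exp_pos _).le (powQ_mul_phi_nonneg hM1 hMk s hη)

lemma integrableOn_integrand_iff {k M : ℕ} (hM1 : 1 ≤ M) (hMk : M ≤ k + 1) (s : Fin (k + 1) → ℝ)
    (y : Matrix (Fin (k + 1)) (Fin (k + 1)) ℝ) :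
    IntegrableOn (integrand M s y) (Q (k + 1)) ↔ laplace M s y < ⊤ := by
  rw [← setLIntegral_integrand hM1 hMk,
    ← hasFiniteIntegral_iff_ofReal (integrand_nonneg hM1 hMk s y)]
  exact ⟨fun h => h.2, fun h => ⟨(measurable_integrand M s y).aestronglyMeasurable, h⟩⟩

lemma powP_pos {n : ℕ} (M : ℕ) (s : Fin n → ℝ) {y : Matrix (Fin n) (Fin n) ℝ} (hy : y ∈ P n) :
    0 < powP M s y :=
  mul_pos (mul_pos (Finset.prod_pos fun _ _ => Real.rpow_pos_of_pos (blockDet_pos hy.2 _ _) _)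
    (Real.rpow_pos_of_pos hy.2.det_pos _))
    (Finset.prod_pos fun _ _ => Real.rpow_pos_of_pos (blockDet_pos hy.2 _ _) _)

lemma gammaFactor_eq_fin {n : ℕ} (M : Fin n) (s : Fin n → ℝ) :
    gammaFactor (M.val + 1) s = ENNReal.ofReal √Real.pi ^ (n - 1)
      * (∏ i ∈ Finset.univ.erase M, gammaENN (s i - 1 / 2)) * gammaENN (s M) := by
  rw [gammaFactor, at1_fin]
  congr 2
  refine (Finset.prod_bij (fun (i : Fin n) _ => i.val + 1) ?_ ?_ ?_ ?_).symm
  · intro i hi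
    simpa [Fin.ext_iff] using hi
  · intro i _ j _ h
    exact Fin.ext (by simpa using h)
  · intro j hj
    simp only [Finset.mem_erase, Finset.mem_Icc] at hj
    exact ⟨⟨j - 1, by omega⟩, by simp [Fin.ext_iff]; omega, by simp; omega⟩
  · intro i _
    rw [at1_fin]

lemma prod_lt_top_iff {ι : Type*} [DecidableEq ι] {t : Finset ι} {f : ι → ℝ≥0∞}
    (hf : ∀ i ∈ t, f i ≠ 0) : ∏ i ∈ t, f i < ⊤ ↔ ∀ i ∈ t, f i < ⊤ := by
  refine ⟨fun h i hi => ?_, fun h => ENNReal.prod_lt_top h⟩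
  rw [← Finset.mul_prod_erase t f hi] at h
  refine ENNReal.lt_top_of_mul_ne_top_left h.ne (Finset.prod_ne_zero_iff.2 fun j hj => ?_)
  exact hf j (Finset.mem_of_mem_erase hj)

lemma gammaFactor_lt_top_iff {n : ℕ} (M : Fin n) (s : Fin n → ℝ) :
    gammaFactor (M.val + 1) s < ⊤ ↔ (∀ i : Fin n, i ≠ M → 1 / 2 < s i) ∧ 0 < s M := by
  have hpi : ENNReal.ofReal √Real.pi ^ (n - 1) ≠ 0 := by
    simp [Real.sqrt_pos.2 Real.pi_pos]
  have hpi' : ENNReal.ofReal √Real.pi ^ (n - 1) ≠ ⊤ := by simp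
  have h0 : ∏ i ∈ Finset.univ.erase M, gammaENN (s i - 1 / 2) ≠ 0 :=
    Finset.prod_ne_zero_iff.2 fun i _ => gammaENN_ne_zero _
  rw [gammaFactor_eq_fin, ENNReal.mul_lt_top_iff, ENNReal.mul_lt_top_iff]
  simp only [hpi, hpi'.lt_top, h0, gammaENN_ne_zero, mul_eq_zero, or_false, true_and]
  rw [prod_lt_top_iff fun i _ => gammaENN_ne_zero _]
  simp [gammaENN_lt_top_iff]

lemma toReal_gammaFactor {n : ℕ} (M : Fin n) {s : Fin n → ℝ}
    (hs : (∀ i : Fin n, i ≠ M → 1 / 2 < s i) ∧ 0 < s M) :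
    (gammaFactor (M.val + 1) s).toReal
      = Real.pi ^ (((n : ℝ) - 1) / 2) * (∏ i ∈ Finset.univ.erase M, Real.Gamma (s i - 1 / 2))
        * Real.Gamma (s M) := by
  have hG : ∀ {r : ℝ}, 0 < r → (gammaENN r).toReal = Real.Gamma r := fun {r} hr => by
    rw [gammaENN, if_pos hr, ENNReal.toReal_ofReal (Real.Gamma_pos_of_pos hr).le]
  rw [gammaFactor_eq_fin, ENNReal.toReal_mul, ENNReal.toReal_mul, ENNReal.toReal_prod,
    ENNReal.toReal_pow, ENNReal.toReal_ofReal (Real.sqrt_nonneg _), hG hs.2]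
  congr 2
  · rw [Real.sqrt_eq_rpow, ← Real.rpow_natCast, ← Real.rpow_mul Real.pi_pos.le,
      Nat.cast_sub (by have := M.2; omega)]
    congr 1
    push_cast
    ring
  · refine Finset.prod_congr rfl fun i hi => hG ?_
    have := hs.1 i (Finset.ne_of_mem_erase hi)
    linarith

end

end AnGraph

/-- The vertex number `M` (between `1` and `n`) is `M.val + 1` for `M : Fin n`. The integrand is
nonnegative on the cone, so that convergence of the integral is integrability. -/
theorem theorem4p1 (n : ℕ) (M : Fin n) (s : Fin n → ℝ)
    (y : Matrix (Fin n) (Fin n) ℝ) (hy : y ∈ AnGraph.P n) :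
    (MeasureTheory.IntegrableOn (AnGraph.integrand (M.val + 1) s y) (AnGraph.Q n)
        MeasureTheory.volume ↔
      (∀ i : Fin n, i ≠ M → 1 / 2 < s i) ∧ 0 < s M) ∧
    ((∀ i : Fin n, i ≠ M → 1 / 2 < s i) ∧ 0 < s M →
      ∫ η in AnGraph.Q n, AnGraph.integrand (M.val + 1) s y η =
        Real.pi ^ (((n : ℝ) - 1) / 2)
          * (∏ i ∈ Finset.univ.erase M, Real.Gamma (s i - 1 / 2))
          * Real.Gamma (s M)
          * AnGraph.powP (M.val + 1) (-s) y) := by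
  obtain ⟨k, rfl⟩ : ∃ k, n = k + 1 := ⟨n - 1, by have := M.2; omega⟩
  have hM1 : 1 ≤ M.val + 1 := by omega
  have hMk : M.val + 1 ≤ k + 1 := M.2
  have hlap := AnGraph.laplace_eq hM1 hMk s hy
  constructor
  · rw [AnGraph.integrableOn_integrand_iff hM1 hMk, hlap, ← AnGraph.gammaFactor_lt_top_iff,
      ENNReal.mul_lt_top_iff]
    have hP := AnGraph.powP_pos (M.val + 1) (-s) hy
    constructor
    · rintro (h | h | h)
      · exact h.1
      · simp [h]
      · exact absurd (ENNReal.ofReal_eq_zero.1 h) hP.not_ge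
    · exact fun h => Or.inl ⟨h, ENNReal.ofReal_lt_top⟩
  · intro hs
    rw [MeasureTheory.integral_eq_lintegral_of_nonneg_ae
        (AnGraph.integrand_nonneg hM1 hMk s y)
        (AnGraph.measurable_integrand _ s y).aestronglyMeasurable,
      AnGraph.setLIntegral_integrand hM1 hMk, hlap, ENNReal.toReal_mul,
      AnGraph.toReal_gammaFactor M hs,
      ENNReal.toReal_ofReal (AnGraph.powP_pos (M.val + 1) (-s) hy).le]
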